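/- Let $X$ be a complex Banach space with open unit ball $\mathbb B$. For $x\in X$ let $J(x)$ be the set of bounded linear functionals $x^*$ on $X$ with $\langle x,x^*\rangle=\|x\|^2=\|x^*\|^2$. Let $a\ge 0$ and let $f:\mathbb B\to X$ be holomorphic (Fréchet differentiable over $\mathbb C$) with $f(0)=0$ and $$\operatorname{Re}\langle f(x),x^*\rangle\ge a\|x\|^2\qquad\text{for all }x\in\mathbb B,\ x^*\in J(x)$$ (that is, $f\in\mathcal N_a$). Put $A=f'(0)$ and $$K:=K_A(\pi)=\sup\{-\operatorname{Re}\langle Au,u^*\rangle:\ \|u\|=1,\ u^*\in J(u)\},$$ and assume that $A$ is strongly accretive, i.e. $X\neq\{0\}$ and $K<0$. For $\lambda>0$ and $r>0$ set $$M_f(r)=\sup_{\|y\|<r}\|f(y)\|\in[0,\infty]\ (r\le 1),\qquad \alpha(\lambda)=\min\Bigl(\frac{3}{1-\lambda K},\frac1{1+\lambda a}\Bigr),\qquad \beta(\lambda)=\frac{\alpha(\lambda)}{\alpha(\lambda)+\lambda M_f(\alpha(\lambda))},$$ where $\beta(\lambda):=0$ if $M_f(\alpha(\lambda))=\infty$.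 Then: 1. For every $\lambda>0$ the resolvent $G_\lambda=(\mathrm{Id}+\lambda f)^{-1}$ is well defined on $\mathbb B$: for each $x\in\mathbb B$ the equation $w+\lambda f(w)=x$ has exactly one solution $w=G_\lambda(x)\in\mathbb B$, and $G_\lambda:\mathbb B\to\mathbb B$ is holomorphic. Moreover $M_f(r)<\infty$ for every $r\in(0,1)$. 2. For all $\lambda>0$ and $x\in\mathbb B$, $$\beta(\lambda)\|x\|\le\|G_\lambda(x)\|\le\alpha(\lambda)\|x\|.$$ 3. $G_\lambda\to0$ uniformly on $\mathbb B$ as $\lambda\to\infty$. 4. If $X$ is finite-dimensional, then for every $\lambda>0$ the image $G_\lambda(\mathbb B)$ contains the open ball of radius $\beta(\lambda)$ centred at $0$. -/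

import Mathlib

namespace NonlinearResolvent

variable {X : Type*} [NormedAddCommGroup X] [NormedSpace ℂ X]

/-- The set `J(x)` of support functionals at `x`: bounded linear functionals `φ` with
`φ x = ‖x‖ ^ 2 = ‖φ‖ ^ 2`. -/
def supportFunctionals (x : X) : Set (X →L[ℂ] ℂ) :=
  {φ | φ x = ((‖x‖ ^ 2 : ℝ) : ℂ) ∧ ‖φ‖ ^ 2 = ‖x‖ ^ 2}

/-- The numerical range `V(A) = {⟨Ax, φ⟩ : ‖x‖ = 1, φ ∈ J(x)}` of a bounded operator. -/
def numericalRange (A : X →L[ℂ] X) : Set ℂ :=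
  {w | ∃ x ∈ Metric.sphere (0 : X) 1, ∃ φ ∈ supportFunctionals x, φ (A x) = w}

/-- The support function `K_A(θ) = sup {Re (e^{-iθ} w) : w ∈ V(A)}` of the numerical range.
(The set is bounded by `‖A‖`, and nonempty as soon as `X ≠ 0`.) -/
noncomputable def supportFunction (A : X →L[ℂ] X) (θ : ℝ) : ℝ :=
  sSup ((fun w : ℂ => (Complex.exp (-(Complex.I * (θ : ℂ))) * w).re) '' numericalRange A)

/-- `A` is strongly accretive when `K_A(π) < 0`, that is, when the infimum of the real parts of
its numerical range is positive. -/
def StronglyAccretive (A : X →L[ℂ] X) : Prop :=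
  supportFunction A Real.pi < 0

/-- The class `N_a`: holomorphic `f : 𝔹 → X` with `f 0 = 0` and `Re ⟨f x, φ⟩ ≥ a ‖x‖ ^ 2` for all
`x ∈ 𝔹`, `φ ∈ J(x)`. Only the values of `f` on the open unit ball `𝔹` matter. -/
structure ClassN (a : ℝ) (f : X → X) : Prop where
  holo : DifferentiableOn ℂ f (Metric.ball 0 1)
  map_zero : f 0 = 0
  accretive : ∀ x ∈ Metric.ball (0 : X) 1, ∀ φ ∈ supportFunctionals x,
    a * ‖x‖ ^ 2 ≤ (φ (f x)).re

/-- `g` is the nonlinear resolvent `(Id + l f)⁻¹` of `f` on the open unit ball `𝔹`: it is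
holomorphic from `𝔹` to `𝔹`, and `g x` is the unique solution `w ∈ 𝔹` of `w + l f(w) = x`,
for each `x ∈ 𝔹`. -/
structure IsResolvent (f : X → X) (l : ℝ) (g : X → X) : Prop where
  holo : DifferentiableOn ℂ g (Metric.ball 0 1)
  mapsTo : Set.MapsTo g (Metric.ball 0 1) (Metric.ball 0 1)
  eqn : ∀ x ∈ Metric.ball (0 : X) 1, g x + (l : ℂ) • f (g x) = x
  unique : ∀ x ∈ Metric.ball (0 : X) 1, ∀ w ∈ Metric.ball (0 : X) 1,
    w + (l : ℂ) • f w = x → w = g x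

/-- `K = K_{f'(0)}(π)`. -/
noncomputable def K (f : X → X) : ℝ :=
  supportFunction (fderiv ℂ f 0) Real.pi

/-- `M_f(r) = sup {‖f y‖ : ‖y‖ < r}`, possibly infinite. -/
noncomputable def M (f : X → X) (r : ℝ) : ENNReal :=
  ⨆ y ∈ Metric.ball (0 : X) r, ENNReal.ofReal ‖f y‖

/-- `α(l) = min (3 / (1 - l K)) (1 / (1 + l a))`. -/
noncomputable def alpha (a : ℝ) (f : X → X) (l : ℝ) : ℝ :=
  min (3 / (1 - l * K f)) (1 / (1 + l * a))

/-- `β(l) = α(l) / (α(l) + l M_f(α(l)))`, computed in `[0, ∞]`. It is at most `1`, and it is `0`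
when `M_f(α(l)) = ∞`, which can only happen when `α(l) = 1`. -/
noncomputable def beta (a : ℝ) (f : X → X) (l : ℝ) : ℝ :=
  (ENNReal.ofReal (alpha a f l) /
    (ENNReal.ofReal (alpha a f l) + ENNReal.ofReal l * M f (alpha a f l))).toReal

end NonlinearResolvent

/-! Estimates. Pairing `w + l f(w) = x` with a support functional at `w` gives `‖w‖² + l Re ψ(f w) ≤
‖w‖‖x‖`. The class condition bounds the pairing below by `a‖w‖²`. A second lower bound comes from
restricting to a complex line: `ζ ↦ φ(f(ζu))/ζ` has nonnegative real part on the disc and real part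
at least `-K` at `0`, so Harnack's inequality applies (`ClassN.bounds`). Together they give `α`.
Schwarz's lemma for `f` on the ball of radius `α` gives `β`, and `α → 0` because `K < 0`.

Existence. With `Φ(x, w) = w + l f(w) - x`, a small step `w - ε Φ(x, w)` maps a ball strictly into
itself, so the Earle-Hamilton theorem yields a unique zero, holomorphic in `x`
(`exists_zero_differentiableOn`). This needs `f` bounded, hence Lipschitz, on smaller balls.

Boundedness. Growth of functions with nonnegative real part bounds only the pairings `ψ(f w)`. To
pass to norms, solve `g = x + ζ Q(g)` for small complex `ζ`: the solution stays in a ball and `g'(0)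
= Q(x)`, so Cauchy's estimate bounds `‖Q x‖`. The argument needs some a priori bound on `Q`, which
does not enter the result; it is therefore applied to the Taylor terms of `f`, and the estimates are
summed as a geometric series (`ClassN.exists_forall_ball_norm_le`). -/

namespace NonlinearResolvent

open Metric Set Filter Topology ComplexConjugate

/-! ### Cauchy estimates and uniform limits of holomorphic maps -/

section UniformLimits

variable {E F : Type*} [NormedAddCommGroup E] [NormedSpace ℂ E]
  [NormedAddCommGroup F] [NormedSpace ℂ F]

/-- Cauchy's estimate for the Fréchet derivative. -/
theorem norm_fderiv_le_of_forall_ball_norm_le {f : E → F} {c : E} {R C : ℝ} (hR : 0 < R)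
    (hf : DifferentiableOn ℂ f (ball c R)) (hC : ∀ z ∈ ball c R, ‖f z‖ ≤ C) :
    ‖fderiv ℂ f c‖ ≤ 2 * C / R := by
  refine Complex.norm_fderiv_le_div_of_mapsTo_ball hf (fun z hz => ?_) hR
  rw [mem_closedBall, dist_eq_norm]
  linarith [norm_sub_le (f z) (f c), hC z hz, hC c (mem_ball_self hR)]

/-- A uniform limit of holomorphic maps between Banach spaces is holomorphic. -/
theorem differentiableOn_of_tendstoUniformlyOn [CompleteSpace F] {U : Set E} (hU : IsOpen U)
    {f : ℕ → E → F} {g : E → F} (hf : ∀ n, DifferentiableOn ℂ (f n) U)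
    (hfg : TendstoUniformlyOn f g atTop U) : DifferentiableOn ℂ g U := by
  intro x hx
  obtain ⟨ρ, hρ, hsub⟩ := Metric.isOpen_iff.1 hU x hx
  have hsub' : ∀ y ∈ ball x (ρ / 2), ball y (ρ / 2) ⊆ U := fun y hy =>
    (ball_subset_ball' (by rw [mem_ball] at hy; linarith)).trans hsub
  have hdiff : ∀ n, ∀ y ∈ ball x (ρ / 2), DifferentiableAt ℂ (f n) y := fun n y hy =>
    (hf n).differentiableAt (hU.mem_nhds (hsub' y hy (mem_ball_self (by linarith))))
  -- Cauchy's estimate on balls of radius `ρ / 2`, applied to `f m - f n`, turns uniform closeness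
  -- of the maps into uniform closeness of their derivatives.
  have hcauchy : UniformCauchySeqOn (fun n => fderiv ℂ (f n)) atTop (ball x (ρ / 2)) := by
    rw [Metric.uniformCauchySeqOn_iff]
    intro ε hε
    obtain ⟨N, hN⟩ := Metric.uniformCauchySeqOn_iff.1 hfg.uniformCauchySeqOn (ε * ρ / 8)
      (by positivity)
    refine ⟨N, fun m hm n hn y hy => ?_⟩
    rw [dist_eq_norm, ← fderiv_sub (hdiff m y hy) (hdiff n y hy)]
    have hle := norm_fderiv_le_of_forall_ball_norm_le (f := f m - f n) (half_pos hρ)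
      (((hf m).sub (hf n)).mono (hsub' y hy)) (C := ε * ρ / 8) (fun z hz => by
        rw [Pi.sub_apply, ← dist_eq_norm]
        exact (hN m hm n hn z (hsub' y hy hz)).le)
    calc _ ≤ 2 * (ε * ρ / 8) / (ρ / 2) := hle
      _ = ε / 2 := by field_simp; norm_num
      _ < ε := by linarith
  have hlim : ∀ y ∈ ball x (ρ / 2), ∃ L, Tendsto (fun n => fderiv ℂ (f n) y) atTop (𝓝 L) :=
    fun y hy => cauchySeq_tendsto_of_complete (hcauchy.cauchySeq hy)
  choose! g' hg' using hlim
  exact (hasFDerivAt_of_tendstoUniformlyOn isOpen_ball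
    (hcauchy.tendstoUniformlyOn_of_tendsto hg') (fun n y hy => (hdiff n y hy).hasFDerivAt)
    (fun y hy => hfg.tendsto_at (hsub' y hy (mem_ball_self (by linarith))))
    (mem_ball_self (half_pos hρ))).differentiableAt.differentiableWithinAt

/-- A bounded holomorphic map is Lipschitz on smaller balls. -/
theorem norm_sub_le_of_forall_ball_norm_le {f : E → F} {R r C : ℝ} (hr : r < R)
    (hf : DifferentiableOn ℂ f (ball 0 R)) (hC : ∀ z ∈ ball 0 R, ‖f z‖ ≤ C)
    {x y : E} (hx : x ∈ ball 0 r) (hy : y ∈ ball 0 r) :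
    ‖f x - f y‖ ≤ 2 * C / (R - r) * ‖x - y‖ := by
  have hsub : ∀ z ∈ ball (0 : E) r, ball z (R - r) ⊆ ball 0 R := fun z hz =>
    ball_subset_ball' (by rw [mem_ball] at hz; linarith)
  refine (convex_ball (0 : E) r).norm_image_sub_le_of_norm_fderiv_le (𝕜 := ℂ)
    (fun z hz => hf.differentiableAt (isOpen_ball.mem_nhds (ball_subset_ball hr.le hz)))
    (fun z hz => ?_) hy hx
  exact norm_fderiv_le_of_forall_ball_norm_le (by linarith) (hf.mono (hsub z hz))
    (fun w hw => hC w (hsub z hz hw))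

end UniformLimits

/-! ### The Earle-Hamilton fixed point theorem -/

section EarleHamilton

variable {E : Type*} [NormedAddCommGroup E] [NormedSpace ℂ E]

/-- Shows that the Möbius map `w ↦ (w - c) / (1 - conj c * w)` preserves the unit disc: the right
side is nonnegative when both points lie in it. -/
theorem normSq_one_sub_conj_mul_sub (c w : ℂ) :
    Complex.normSq (1 - conj c * w) - Complex.normSq (w - c) =
      (1 - Complex.normSq c) * (1 - Complex.normSq w) := by
  simp only [Complex.normSq_apply, Complex.sub_re, Complex.sub_im, Complex.mul_re, Complex.mul_im,
    Complex.conj_re, Complex.conj_im, Complex.one_re, Complex.one_im]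
  ring

/-- The Schwarz-Pick inequality between the centre and a point of a ball. -/
theorem norm_sub_le_mul_norm_one_sub {h : E → ℂ} {s : ℝ}
    (hd : DifferentiableOn ℂ h (ball 0 s)) (h1 : ∀ y ∈ ball 0 s, ‖h y‖ < 1) {z : E}
    (hz : z ∈ ball 0 s) : ‖h z - h 0‖ ≤ ‖z‖ / s * ‖1 - conj (h 0) * h z‖ := by
  have hs : 0 < s := nonempty_ball.1 ⟨z, hz⟩
  have hne : ∀ y ∈ ball (0 : E) s, 1 - conj (h 0) * h y ≠ 0 := by
    intro y hy h0
    have : ‖conj (h 0) * h y‖ < 1 := by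
      rw [norm_mul, RCLike.norm_conj]
      nlinarith [h1 0 (mem_ball_self hs), h1 y hy, norm_nonneg (h 0), norm_nonneg (h y)]
    rw [← sub_eq_zero.1 h0] at this
    simp at this
  have hmaps : MapsTo (fun y => (h y - h 0) / (1 - conj (h 0) * h y)) (ball 0 s)
      (closedBall ((fun y => (h y - h 0) / (1 - conj (h 0) * h y)) 0) 1) := by
    intro y hy
    simp only [sub_self, zero_div, mem_closedBall, dist_zero_right, norm_div]
    rw [div_le_one (norm_pos_iff.2 (hne y hy)), ← sq_le_sq₀ (norm_nonneg _) (norm_nonneg _),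
      ← Complex.normSq_eq_norm_sq, ← Complex.normSq_eq_norm_sq, ← sub_nonneg,
      normSq_one_sub_conj_mul_sub, Complex.normSq_eq_norm_sq, Complex.normSq_eq_norm_sq]
    have := h1 y hy
    have := h1 0 (mem_ball_self hs)
    refine mul_nonneg ?_ ?_ <;> rw [sub_nonneg] <;> exact pow_le_one₀ (norm_nonneg _) (by linarith)
  have key := Complex.dist_le_div_mul_dist_of_mapsTo_ball
    (f := fun y => (h y - h 0) / (1 - conj (h 0) * h y)) (by
      simp only [div_eq_mul_inv]
      exact (hd.sub_const (h 0)).mul (((differentiableOn_const (1 : ℂ)).sub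
        (hd.const_mul (conj (h 0)))).inv hne)) hmaps hz
  simp only [sub_self, zero_div, dist_zero_right, norm_div] at key
  have hp := norm_pos_iff.2 (hne z hz)
  rw [div_le_iff₀ hp] at key
  calc _ ≤ _ := key
    _ = _ := by ring

/-- A pseudohyperbolic disc of radius `r` is contained in a Euclidean disc of radius `r`. -/
theorem norm_sub_le_of_norm_sub_le_mul_norm_one_sub {c w : ℂ} {r : ℝ} (hr0 : 0 ≤ r) (hr1 : r < 1)
    (hc : ‖c‖ < 1) (h : ‖w - c‖ ≤ r * ‖1 - conj c * w‖) :
    ‖w - (((1 - r ^ 2) / (1 - r ^ 2 * ‖c‖ ^ 2) : ℝ) : ℂ) * c‖ ≤ r := by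
  have hr2 : r ^ 2 < 1 := pow_lt_one₀ hr0 hr1 two_ne_zero
  have ht : ‖c‖ ^ 2 < 1 := pow_lt_one₀ (norm_nonneg _) hc two_ne_zero
  have ht0 : 0 ≤ ‖c‖ ^ 2 := sq_nonneg _
  have hd : 0 < 1 - r ^ 2 * ‖c‖ ^ 2 := by nlinarith [sq_nonneg r]
  have h2 : ‖w - c‖ ^ 2 ≤ r ^ 2 * ‖1 - conj c * w‖ ^ 2 := by
    rw [← mul_pow]; exact pow_le_pow_left₀ (norm_nonneg _) h 2
  set t := ‖c‖ ^ 2 with htdef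
  have htn : t = c.re * c.re + c.im * c.im := by
    rw [htdef, ← Complex.normSq_eq_norm_sq, Complex.normSq_apply]
  set e := (1 - r ^ 2) / (1 - r ^ 2 * t) with he
  have hed : e * (1 - r ^ 2 * t) = 1 - r ^ 2 := div_mul_cancel₀ _ hd.ne'
  rw [← Complex.normSq_eq_norm_sq, ← Complex.normSq_eq_norm_sq, Complex.normSq_apply,
    Complex.normSq_apply] at h2
  simp only [Complex.sub_re, Complex.sub_im, Complex.mul_re, Complex.mul_im,
    Complex.conj_re, Complex.conj_im, Complex.one_re, Complex.one_im] at h2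
  rw [← sq_le_sq₀ (norm_nonneg _) hr0, ← Complex.normSq_eq_norm_sq, Complex.normSq_apply]
  simp only [Complex.sub_re, Complex.sub_im, Complex.mul_re, Complex.mul_im,
    Complex.ofReal_re, Complex.ofReal_im, zero_mul, sub_zero, add_zero]
  -- The pseudohyperbolic disc is exactly the Euclidean disc with centre `e * c` and radius `r * q`;
  -- the sharp radius is proved first and then `q ≤ 1` is used.
  have hrad : (1 - t) / (1 - r ^ 2 * t) ≤ 1 := by
    rw [div_le_one hd]; nlinarith
  have hrad0 : 0 ≤ (1 - t) / (1 - r ^ 2 * t) := div_nonneg (by linarith) hd.le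
  set q := (1 - t) / (1 - r ^ 2 * t) with hq
  have hqd : q * (1 - r ^ 2 * t) = 1 - t := div_mul_cancel₀ _ hd.ne'
  have hfin : r ^ 2 * q ^ 2 ≤ r ^ 2 :=
    mul_le_of_le_one_right (sq_nonneg r) (pow_le_one₀ hrad0 hrad)
  refine le_trans ?_ hfin
  rw [← mul_le_mul_iff_right₀ hd]
  set d := 1 - r ^ 2 * t with hdd
  have e1 : d * ((w.re - e * c.re) * (w.re - e * c.re) + (w.im - e * c.im) * (w.im - e * c.im)) =
      d * (w.re * w.re + w.im * w.im) - 2 * (e * d) * (c.re * w.re + c.im * w.im)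
        + e * (e * d) * t := by rw [htn]; ring
  have e2 : d * (r ^ 2 * q ^ 2) = r ^ 2 * q * (q * d) := by ring
  have e3 : r ^ 2 * q * (1 - t) = r ^ 2 - t + e * (1 - r ^ 2) * t := by
    have : d * (r ^ 2 * q * (1 - t)) = d * (r ^ 2 - t + e * (1 - r ^ 2) * t) := by
      calc _ = r ^ 2 * (q * d) * (1 - t) := by ring
        _ = d * (r ^ 2 - t) + (e * d) * (1 - r ^ 2) * t := by rw [hqd, hed, hdd]; ring
        _ = _ := by ring
    exact mul_left_cancel₀ hd.ne' this
  rw [e1, e2, hqd, hed, e3, hdd]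
  have e4 : (w.re - c.re) * (w.re - c.re) + (w.im - c.im) * (w.im - c.im) =
      w.re * w.re + w.im * w.im - 2 * (c.re * w.re + c.im * w.im) + t := by rw [htn]; ring
  have e5 : (1 - (c.re * w.re - -c.im * w.im)) * (1 - (c.re * w.re - -c.im * w.im)) +
        (0 - (c.re * w.im + -c.im * w.re)) * (0 - (c.re * w.im + -c.im * w.re)) =
      1 - 2 * (c.re * w.re + c.im * w.im) + t * (w.re * w.re + w.im * w.im) := by rw [htn]; ring
  rw [e4, e5] at h2
  linear_combination h2

variable {S : E → E} {s s₁ : ℝ}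

/-- If `S` maps a ball strictly into itself, composition with `S` contracts the oscillation of
holomorphic functions into the unit disc. -/
theorem norm_comp_iterate_sub_le (hs₁ : 0 ≤ s₁) (hs : s₁ < s)
    (hS : DifferentiableOn ℂ S (ball 0 s)) (hmaps : MapsTo S (ball 0 s) (closedBall 0 s₁)) {r : ℝ}
    (hr : s₁ / s < r) (n : ℕ) :
    ∀ h : E → ℂ, DifferentiableOn ℂ h (ball 0 s) → (∀ y ∈ ball 0 s, ‖h y‖ < 1) →
      ∀ y ∈ ball (0 : E) s, ∀ z ∈ ball (0 : E) s, ‖h (S^[n] y) - h (S^[n] z)‖ ≤ 2 * r ^ n := by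
  have hs0 : 0 < s := hs₁.trans_lt hs
  have hq0 : 0 ≤ s₁ / s := by positivity
  have hq1 : s₁ / s < 1 := (div_lt_one hs0).2 hs
  have hr0 : 0 < r := hq0.trans_lt hr
  have hmaps' : MapsTo S (ball 0 s) (ball 0 s) := hmaps.mono_right (closedBall_subset_ball hs)
  induction n with
  | zero =>
    intro h hd h1 y hy z hz
    simp only [Function.iterate_zero, id, pow_zero]
    linarith [norm_sub_le (h y) (h z), h1 y hy, h1 z hz]
  | succ n ih =>
    intro h hd h1 y hy z hz
    set c := h 0
    -- By Schwarz-Pick `h ∘ S` takes values in a Euclidean disc of radius `s₁ / s` centred at `c'`.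
    -- Recentring and dividing by the slightly larger `r` gives another function into the open unit
    -- disc, so each application of `S` gains a factor `r`.
    set c' : ℂ := (((1 - (s₁ / s) ^ 2) / (1 - (s₁ / s) ^ 2 * ‖c‖ ^ 2) : ℝ) : ℂ) * c
    have hbound : ∀ w ∈ ball (0 : E) s, ‖h (S w) - c'‖ ≤ s₁ / s := by
      intro w hw
      refine norm_sub_le_of_norm_sub_le_mul_norm_one_sub hq0 hq1 (h1 0 (mem_ball_self hs0)) ?_
      refine (norm_sub_le_mul_norm_one_sub hd h1 (hmaps' hw)).trans ?_
      have := mem_closedBall_zero_iff.1 (hmaps hw)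
      gcongr
    have hd' : DifferentiableOn ℂ (fun w => (h (S w) - c') / (r : ℂ)) (ball 0 s) :=
      (((hd.comp hS hmaps').sub_const c').mul_const (r : ℂ)⁻¹)
    have h1' : ∀ w ∈ ball (0 : E) s, ‖(h (S w) - c') / (r : ℂ)‖ < 1 := by
      intro w hw
      rw [norm_div, Complex.norm_real, Real.norm_of_nonneg hr0.le, div_lt_one hr0]
      exact (hbound w hw).trans_lt hr
    have := ih _ hd' h1' y hy z hz
    rw [← sub_div, norm_div, Complex.norm_real, Real.norm_of_nonneg hr0.le, div_le_iff₀ hr0,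
      sub_sub_sub_cancel_right, ← Function.iterate_succ_apply' S, ← Function.iterate_succ_apply' S]
      at this
    calc _ ≤ _ := this
      _ = _ := by ring

/-- Iterates of a holomorphic map of a ball strictly into itself contract geometrically. -/
theorem norm_iterate_sub_le (hs₁ : 0 ≤ s₁) (hs : s₁ < s)
    (hS : DifferentiableOn ℂ S (ball 0 s)) (hmaps : MapsTo S (ball 0 s) (closedBall 0 s₁)) {r : ℝ}
    (hr : s₁ / s < r) (n : ℕ) {y z : E} (hy : y ∈ ball 0 s) (hz : z ∈ ball 0 s) :
    ‖S^[n] y - S^[n] z‖ ≤ 2 * s * r ^ n := by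
  have hs0 : 0 < s := hs₁.trans_lt hs
  obtain ⟨φ, hφ, hφx⟩ := exists_dual_vector'' ℂ (S^[n] y - S^[n] z)
  have := norm_comp_iterate_sub_le hs₁ hs hS hmaps hr n (fun w => φ w / (s : ℂ))
    (φ.differentiable.differentiableOn.mul_const (s : ℂ)⁻¹) (fun w hw => by
      rw [norm_div, Complex.norm_real, Real.norm_of_nonneg hs0.le, div_lt_one hs0]
      rw [mem_ball_zero_iff] at hw
      calc ‖φ w‖ ≤ ‖φ‖ * ‖w‖ := φ.le_opNorm w
        _ ≤ 1 * ‖w‖ := by gcongr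
        _ < s := by linarith) y hy z hz
  rw [← sub_div, ← map_sub, hφx, norm_div, Complex.norm_real, Real.norm_of_nonneg hs0.le,
    div_le_iff₀ hs0] at this
  simp only [Complex.coe_algebraMap, Complex.norm_real, norm_norm] at this
  linarith

/-- The Earle-Hamilton fixed point theorem on a ball, with holomorphic dependence on a
parameter. -/
theorem exists_fixedPoint_differentiableOn [CompleteSpace E] {Y : Type*} [NormedAddCommGroup Y]
    [NormedSpace ℂ Y] {U : Set Y} (hU : IsOpen U) (hs₁ : 0 ≤ s₁) (hs : s₁ < s) {T : Y × E → E}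
    (hT : DifferentiableOn ℂ T (U ×ˢ ball 0 s))
    (hmaps : ∀ ξ ∈ U, ∀ w ∈ ball (0 : E) s, T (ξ, w) ∈ closedBall 0 s₁) :
    ∃ g : Y → E, DifferentiableOn ℂ g U ∧ ∀ ξ ∈ U, g ξ ∈ ball 0 s ∧ T (ξ, g ξ) = g ξ ∧
      ∀ w ∈ ball 0 s, T (ξ, w) = w → w = g ξ := by
  have hs0 : 0 < s := hs₁.trans_lt hs
  obtain ⟨r, hr, hr1⟩ := exists_between ((div_lt_one hs0).2 hs)
  have hr0 : 0 ≤ r := (div_nonneg hs₁ hs0.le).trans hr.le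
  set S : Y → E → E := fun ξ w => T (ξ, w)
  have hS : ∀ ξ ∈ U, DifferentiableOn ℂ (S ξ) (ball 0 s) := fun ξ hξ =>
    hT.comp (f := fun w => (ξ, w)) (by fun_prop) (fun w hw => ⟨hξ, hw⟩)
  have hmaps' : ∀ ξ ∈ U, MapsTo (S ξ) (ball 0 s) (ball 0 s) := fun ξ hξ w hw =>
    closedBall_subset_ball hs (hmaps ξ hξ w hw)
  have h0 : (0 : E) ∈ ball 0 s := mem_ball_self hs0
  have hcontr : ∀ ξ ∈ U, ∀ n, ∀ y ∈ ball (0 : E) s, ∀ z ∈ ball (0 : E) s,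
      ‖(S ξ)^[n] y - (S ξ)^[n] z‖ ≤ 2 * s * r ^ n := fun ξ hξ n y hy z hz =>
    norm_iterate_sub_le hs₁ hs (hS ξ hξ) (hmaps ξ hξ) hr n hy hz
  have htend0 : Tendsto (fun n : ℕ => 2 * s * r ^ n) atTop (𝓝 0) := by
    simpa using (tendsto_pow_atTop_nhds_zero_of_lt_one hr0 hr1).const_mul (2 * s)
  have hlim : ∀ ξ ∈ U, ∃ L, Tendsto (fun n => (S ξ)^[n] 0) atTop (𝓝 L) := by
    intro ξ hξ
    refine cauchySeq_tendsto_of_complete (cauchySeq_of_le_tendsto_0' (fun n => 2 * s * r ^ n) ?_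
      htend0)
    intro n m hnm
    obtain ⟨k, rfl⟩ := Nat.exists_eq_add_of_le hnm
    rw [dist_eq_norm, Function.iterate_add_apply]
    exact hcontr ξ hξ n _ h0 _ ((hmaps' ξ hξ).iterate k h0)
  choose! g hg using hlim
  have hgball : ∀ ξ ∈ U, g ξ ∈ ball 0 s := by
    intro ξ hξ
    refine closedBall_subset_ball hs (isClosed_closedBall.mem_of_tendsto
      ((tendsto_add_atTop_iff_nat 1).2 (hg ξ hξ)) (Eventually.of_forall fun n => ?_))
    rw [Function.iterate_succ_apply']
    exact hmaps ξ hξ _ ((hmaps' ξ hξ).iterate n h0)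
  have hgfix : ∀ ξ ∈ U, T (ξ, g ξ) = g ξ := by
    intro ξ hξ
    have hcont : ContinuousAt (S ξ) (g ξ) :=
      ((hS ξ hξ).differentiableAt (isOpen_ball.mem_nhds (hgball ξ hξ))).continuousAt
    refine tendsto_nhds_unique (hcont.tendsto.comp (hg ξ hξ)) ?_
    simpa only [Function.iterate_succ_apply'] using! (tendsto_add_atTop_iff_nat 1).2 (hg ξ hξ)
  -- The contraction rate does not depend on `ξ`, hence the holomorphic iterates of `0` converge
  -- uniformly in the parameter.
  have hunif : TendstoUniformlyOn (fun n ξ => (S ξ)^[n] 0) g atTop U := by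
    rw [Metric.tendstoUniformlyOn_iff]
    intro ε hε
    filter_upwards [htend0.eventually_lt_const hε] with n hn ξ hξ
    have := hcontr ξ hξ n _ (hgball ξ hξ) _ h0
    rw [Function.iterate_fixed (hgfix ξ hξ)] at this
    rw [dist_eq_norm]
    exact this.trans_lt hn
  refine ⟨g, differentiableOn_of_tendstoUniformlyOn hU (fun n => ?_) hunif, fun ξ hξ =>
    ⟨hgball ξ hξ, hgfix ξ hξ, fun w hw hfix => ?_⟩⟩
  · induction n with
    | zero => simp
    | succ n ih =>
      simp only [Function.iterate_succ_apply']
      exact hT.comp (f := fun ξ => (ξ, (S ξ)^[n] 0)) (differentiableOn_id.prodMk ih)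
        (fun ξ hξ => ⟨hξ, (hmaps' ξ hξ).iterate n h0⟩)
  · refine sub_eq_zero.1 (norm_le_zero_iff.1 (ge_of_tendsto' htend0 fun n => ?_))
    have := hcontr ξ hξ n _ hw _ (hgball ξ hξ)
    rwa [Function.iterate_fixed (show S ξ w = w from hfix),
      Function.iterate_fixed (show S ξ (g ξ) = g ξ from hgfix ξ hξ)] at this

end EarleHamilton

/-! ### Support functionals and zeros of accretive maps -/

section Zeros

variable {X : Type*} [NormedAddCommGroup X] [NormedSpace ℂ X]

theorem norm_eq_of_mem_supportFunctionals {x : X} {φ : X →L[ℂ] ℂ}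
    (h : φ ∈ supportFunctionals x) : ‖φ‖ = ‖x‖ :=
  (sq_eq_sq₀ (norm_nonneg _) (norm_nonneg _)).1 h.2

theorem re_apply_self_of_mem_supportFunctionals {x : X} {φ : X →L[ℂ] ℂ}
    (h : φ ∈ supportFunctionals x) : (φ x).re = ‖x‖ ^ 2 := by
  rw [h.1, Complex.ofReal_re]

theorem norm_apply_le_of_mem_supportFunctionals {x : X} {φ : X →L[ℂ] ℂ}
    (h : φ ∈ supportFunctionals x) (y : X) : ‖φ y‖ ≤ ‖x‖ * ‖y‖ :=
  norm_eq_of_mem_supportFunctionals h ▸ φ.le_opNorm y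

theorem re_apply_le_of_mem_supportFunctionals {x : X} {φ : X →L[ℂ] ℂ}
    (h : φ ∈ supportFunctionals x) (y : X) : (φ y).re ≤ ‖x‖ * ‖y‖ :=
  (Complex.re_le_norm _).trans (norm_apply_le_of_mem_supportFunctionals h y)

theorem supportFunctionals_nonempty (x : X) : (supportFunctionals x).Nonempty := by
  obtain rfl | hx := eq_or_ne x 0
  · exact ⟨0, by simp [supportFunctionals]⟩
  · obtain ⟨g, hg, hgx⟩ := exists_dual_vector ℂ x (norm_ne_zero_iff.2 hx)
    refine ⟨(‖x‖ : ℂ) • g, ?_, ?_⟩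
    · rw [_root_.smul_apply, hgx]
      simp [sq]
    · rw [norm_smul, hg]; simp

/-- Lets a single functional serve along a whole complex line, which is what reduces questions about
`f` to one complex variable. -/
theorem smul_mem_supportFunctionals {x : X} {φ : X →L[ℂ] ℂ} (h : φ ∈ supportFunctionals x)
    (z : ℂ) : conj z • φ ∈ supportFunctionals (z • x) := by
  refine ⟨?_, ?_⟩
  · rw [_root_.smul_apply, map_smul, h.1, norm_smul, mul_pow,
      smul_eq_mul, smul_eq_mul, ← mul_assoc, ← Complex.normSq_eq_conj_mul_self,
      Complex.normSq_eq_norm_sq, Complex.ofReal_mul]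
  · rw [norm_smul, norm_smul, RCLike.norm_conj, mul_pow, mul_pow, h.2]

/-- If `Re ⟨Φ(ξ, v), ψ⟩ ≥ ‖v‖ (‖v‖ - q)` for all `v` and `ψ ∈ J(v)`, then `Φ(ξ, ·)` has exactly
one zero in every ball of radius larger than `q`, and the zero is holomorphic in `ξ`. -/
theorem exists_zero_differentiableOn [CompleteSpace X] {Y : Type*} [NormedAddCommGroup Y]
    [NormedSpace ℂ Y] {U : Set Y} (hU : IsOpen U) {q s s' N L : ℝ} (hq : 0 ≤ q) (hqs : q < s)
    (hs : s < s') (hN : 0 ≤ N) (hL : 0 ≤ L) {Φ : Y × X → X}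
    (hΦ : DifferentiableOn ℂ Φ (U ×ˢ ball 0 s'))
    (hbound : ∀ ξ ∈ U, ∀ w ∈ ball (0 : X) s', ‖Φ (ξ, w)‖ ≤ N)
    (hlip : ∀ ξ ∈ U, ∀ w ∈ ball (0 : X) s', ∀ v ∈ ball (0 : X) s',
      ‖Φ (ξ, w) - Φ (ξ, v)‖ ≤ L * ‖w - v‖)
    (hacc : ∀ ξ ∈ U, ∀ v ∈ ball (0 : X) s', ∀ ψ ∈ supportFunctionals v,
      ‖v‖ * (‖v‖ - q) ≤ (ψ (Φ (ξ, v))).re) :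
    ∃ g : Y → X, DifferentiableOn ℂ g U ∧ ∀ ξ ∈ U, g ξ ∈ ball 0 s ∧ Φ (ξ, g ξ) = 0 ∧
      ∀ w ∈ ball 0 s, Φ (ξ, w) = 0 → w = g ξ := by
  obtain ⟨ε₁, hε₁, h₁⟩ := exists_pos_mul_lt (sub_pos.2 hs) N
  obtain ⟨ε₂, hε₂, h₂⟩ := exists_pos_mul_lt (sub_pos.2 hqs) (L * N)
  -- The first condition keeps the image of the step inside the ball of radius `s'`; the second
  -- makes the error `ε * (L * N * ε)` smaller than the gain `ε * (s - q)`.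
  obtain ⟨ε, hε, hεN, hεL⟩ : ∃ ε > 0, N * ε < s' - s ∧ L * N * ε < s - q :=
    ⟨min ε₁ ε₂, lt_min hε₁ hε₂,
      (mul_le_mul_of_nonneg_left (min_le_left _ _) hN).trans_lt h₁,
      (mul_le_mul_of_nonneg_left (min_le_right _ _) (mul_nonneg hL hN)).trans_lt h₂⟩
  have hs0 : 0 < s := hq.trans_lt hqs
  set s₁ := (s + ε * q + ε * (L * N * ε)) / (1 + ε) with hs₁
  have hs₁0 : 0 ≤ s₁ := by positivity
  have hs₁s : s₁ < s := by
    rw [hs₁, div_lt_iff₀ (by linarith)]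
    nlinarith
  set T : Y × X → X := fun p => p.2 - (ε : ℂ) • Φ p with hTdef
  have hεnorm : ‖(ε : ℂ)‖ = ε := by rw [Complex.norm_real, Real.norm_of_nonneg hε.le]
  have hT : DifferentiableOn ℂ T (U ×ˢ ball 0 s) :=
    differentiableOn_snd.sub
      ((hΦ.mono (prod_mono_right (ball_subset_ball hs.le))).const_smul (ε : ℂ))
  have hmaps : ∀ ξ ∈ U, ∀ w ∈ ball (0 : X) s, T (ξ, w) ∈ closedBall 0 s₁ := by
    intro ξ hξ w hw
    have hw' : w ∈ ball (0 : X) s' := ball_subset_ball hs.le hw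
    have hws := mem_ball_zero_iff.1 hw
    set v := T (ξ, w) with hv
    have hwv : w - v = (ε : ℂ) • Φ (ξ, w) := by simp [hv, hTdef]
    have hwv' : ‖w - v‖ ≤ N * ε := by
      rw [hwv, norm_smul, hεnorm, mul_comm]
      exact mul_le_mul_of_nonneg_right (hbound ξ hξ w hw') hε.le
    have hv' : v ∈ ball (0 : X) s' := by
      rw [mem_ball_zero_iff]
      linarith [norm_sub_norm_le v w, norm_sub_rev v w]
    rw [mem_closedBall_zero_iff]
    obtain hv0 | hv0 := (norm_nonneg v).eq_or_lt
    · rwa [← hv0]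
    -- The functional is taken at the image `v`, so that `φ v = ‖v‖²`. Accretivity is then used at
    -- `v`, and replacing `Φ(ξ, w)` by `Φ(ξ, v)` costs only the Lipschitz error.
    obtain ⟨φ, hφ⟩ := supportFunctionals_nonempty v
    have e1 : (φ v).re = (φ w).re - ε * (φ (Φ (ξ, v))).re
        - ε * (φ (Φ (ξ, w) - Φ (ξ, v))).re := by
      have : v = w - (ε : ℂ) • Φ (ξ, v) - (ε : ℂ) • (Φ (ξ, w) - Φ (ξ, v)) := by
        rw [sub_sub, ← smul_add, add_sub_cancel, ← hwv, sub_sub_cancel]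
      conv_lhs => rw [this]
      simp only [map_sub, map_smul, smul_eq_mul, Complex.sub_re, Complex.re_ofReal_mul]
    rw [re_apply_self_of_mem_supportFunctionals hφ] at e1
    have e2 := re_apply_le_of_mem_supportFunctionals hφ w
    have e3 := hacc ξ hξ v hv' φ hφ
    have e4 : -(φ (Φ (ξ, w) - Φ (ξ, v))).re ≤ ‖v‖ * (L * N * ε) := by
      refine (neg_le_abs _).trans ((Complex.abs_re_le_norm _).trans
        ((norm_apply_le_of_mem_supportFunctionals hφ _).trans ?_))
      gcongr
      calc _ ≤ L * ‖w - v‖ := hlip ξ hξ w hw' v hv'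
        _ ≤ L * (N * ε) := by gcongr
        _ = _ := by ring
    have e5 : ‖v‖ * (‖v‖ * (1 + ε)) ≤ ‖v‖ * (s + ε * q + ε * (L * N * ε)) := by
      have h3 := mul_le_mul_of_nonneg_left e3 hε.le
      have h4 := mul_le_mul_of_nonneg_left e4 hε.le
      have h5 := mul_le_mul_of_nonneg_left hws.le hv0.le
      nlinarith
    rw [hs₁, le_div_iff₀ (by linarith)]
    exact le_of_mul_le_mul_left e5 hv0
  have hfix : ∀ ξ w, T (ξ, w) = w ↔ Φ (ξ, w) = 0 := by
    intro ξ w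
    simp [hTdef, hε.ne']
  simpa only [hfix] using exists_fixedPoint_differentiableOn hU hs₁0 hs₁s hT hmaps

/-- A bounded holomorphic map is controlled on smaller balls by its numerical range. -/
theorem norm_apply_le_of_norm_supportFunctional_le [CompleteSpace X] {Q : X → X} {s s' C c : ℝ}
    (hs : s < s') (hQ : DifferentiableOn ℂ Q (ball 0 s')) (hC : ∀ w ∈ ball (0 : X) s', ‖Q w‖ ≤ C)
    (hc : 0 < c) (hQc : ∀ w ∈ ball (0 : X) s', ∀ ψ ∈ supportFunctionals w, ‖ψ (Q w)‖ ≤ c * ‖w‖)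
    {x : X} (hx : ‖x‖ < s) : ‖Q x‖ ≤ 4 * s * c / (s - ‖x‖) := by
  have hs0 : 0 < s := (norm_nonneg x).trans_lt hx
  have hC0 : 0 ≤ C := (norm_nonneg _).trans (hC 0 (mem_ball_self (hs0.trans hs)))
  obtain ⟨t, hst, hts⟩ := exists_between hs
  have htsub : ball (0 : X) t ⊆ ball 0 s' := ball_subset_ball hts.le
  -- Chosen so that `q = ‖x‖ + ρ * c` is the midpoint of `‖x‖` and `s`. The bound `C` affects only
  -- `N` and `L`, not `ρ`.
  set ρ := (s - ‖x‖) / (2 * c) with hρ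
  have hρ0 : 0 < ρ := div_pos (by linarith) (by linarith)
  have hρc : ρ * c = (s - ‖x‖) / 2 := by rw [hρ]; field_simp
  have hL : 0 ≤ 2 * C / (s' - t) := div_nonneg (by linarith) (by linarith)
  obtain ⟨g, hg, hgz⟩ := exists_zero_differentiableOn (U := ball (0 : ℂ) ρ) isOpen_ball
    (q := ‖x‖ + ρ * c) (s := s) (s' := t) (N := t + ρ * C + ‖x‖)
    (L := 1 + ρ * (2 * C / (s' - t))) (Φ := fun p => p.2 - p.1 • Q p.2 - x)
    (by positivity) (by linarith) hst
    (by have := hs0.trans hst; positivity) (by positivity)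
    ((differentiableOn_snd.sub (differentiableOn_fst.smul
      (hQ.comp differentiableOn_snd fun p hp => htsub hp.2))).sub_const x)
    (fun ζ hζ w hw => by
      have h1 := mem_ball_zero_iff.1 hζ
      have h2 := mem_ball_zero_iff.1 hw
      have h3 : ‖ζ • Q w‖ ≤ ρ * C := by
        rw [norm_smul]
        exact mul_le_mul h1.le (hC w (htsub hw)) (norm_nonneg _) hρ0.le
      linarith [norm_sub_le (w - ζ • Q w) x, norm_sub_le w (ζ • Q w)])
    (fun ζ hζ w hw v hv => by
      have h1 := mem_ball_zero_iff.1 hζ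
      have h2 : ‖ζ • (Q w - Q v)‖ ≤ ρ * (2 * C / (s' - t) * ‖w - v‖) := by
        rw [norm_smul]
        exact mul_le_mul h1.le (norm_sub_le_of_forall_ball_norm_le hts hQ hC hw hv)
          (norm_nonneg _) hρ0.le
      calc _ = ‖(w - v) - ζ • (Q w - Q v)‖ := by
            congr 1; simp only [smul_sub]; abel
        _ ≤ ‖w - v‖ + ‖ζ • (Q w - Q v)‖ := norm_sub_le _ _
        _ ≤ _ := by linarith)
    (fun ζ hζ v hv ψ hψ => by
      have h1 := mem_ball_zero_iff.1 hζ
      have h2 : (ζ * ψ (Q v)).re ≤ ρ * (c * ‖v‖) := by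
        refine (Complex.re_le_norm _).trans ?_
        rw [norm_mul]
        exact mul_le_mul h1.le (hQc v (htsub hv) ψ hψ) (norm_nonneg _) hρ0.le
      have h3 := re_apply_le_of_mem_supportFunctionals hψ x
      have h4 := re_apply_self_of_mem_supportFunctionals hψ
      simp only [map_sub, map_smul, smul_eq_mul, Complex.sub_re]
      rw [h4]
      nlinarith)
  have h00 : (0 : ℂ) ∈ ball (0 : ℂ) ρ := mem_ball_self hρ0
  have hgeq : ∀ ζ ∈ ball (0 : ℂ) ρ, g ζ = x + ζ • Q (g ζ) := fun ζ hζ => by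
    exact sub_eq_iff_eq_add.1 (sub_eq_zero.1 (hgz ζ hζ).2.1)
  have hg0 : g 0 = x := by simpa using hgeq 0 h00
  have hgd : HasDerivAt g (deriv g 0) 0 :=
    (hg.differentiableAt (isOpen_ball.mem_nhds h00)).hasDerivAt
  have hxs' : g 0 ∈ ball (0 : X) s' := by
    rw [hg0, mem_ball_zero_iff]; linarith
  have hQg : DifferentiableAt ℂ (fun ζ => Q (g ζ)) 0 :=
    (hQ.differentiableAt (isOpen_ball.mem_nhds hxs')).comp 0 hgd.differentiableAt
  -- Differentiate `g ζ = x + ζ • Q (g ζ)` at `ζ = 0`, where `g 0 = x`.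
  have hderiv : deriv g 0 = Q x := by
    have h1 : HasDerivAt (fun ζ : ℂ => x + ζ • Q (g ζ)) (Q x) 0 := by
      simpa [hg0] using! ((hasDerivAt_id (0 : ℂ)).smul hQg.hasDerivAt).const_add x
    refine hgd.unique (h1.congr_of_eventuallyEq ?_)
    filter_upwards [isOpen_ball.mem_nhds h00] with ζ hζ using hgeq ζ hζ
  rw [← hderiv]
  calc _ ≤ 2 * s / ρ := by
        refine Complex.norm_deriv_le_div_of_mapsTo_ball hg (fun ζ hζ => ?_) hρ0
        rw [mem_closedBall, dist_eq_norm]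
        linarith [norm_sub_le (g ζ) (g 0), mem_ball_zero_iff.1 (hgz ζ hζ).1,
          mem_ball_zero_iff.1 (hgz 0 h00).1]
    _ = _ := by
        rw [hρ]; field_simp; norm_num

end Zeros

/-! ### Harnack and growth estimates in the unit disc -/

section Harnack

/-- A holomorphic function on the unit disc with nonnegative real part satisfies the Schwarz
inequality after a Cayley transform. -/
theorem norm_sub_le_norm_mul_norm_add_conj {h : ℂ → ℂ} (hd : DifferentiableOn ℂ h (ball 0 1))
    (hre : ∀ z ∈ ball (0 : ℂ) 1, 0 ≤ (h z).re) (h0 : 0 < (h 0).re) {z : ℂ} (hz : z ∈ ball 0 1) :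
    ‖h z - h 0‖ ≤ ‖z‖ * ‖h z + conj (h 0)‖ := by
  have hne : ∀ y ∈ ball (0 : ℂ) 1, h y + conj (h 0) ≠ 0 := fun y hy he => by
    have := congrArg Complex.re he
    simp only [Complex.add_re, Complex.conj_re, Complex.zero_re] at this
    linarith [hre y hy]
  have hmaps : MapsTo (fun y => (h y - h 0) / (h y + conj (h 0))) (ball 0 1)
      (closedBall ((fun y => (h y - h 0) / (h y + conj (h 0))) 0) 1) := by
    intro y hy
    simp only [sub_self, zero_div, mem_closedBall, dist_zero_right, norm_div]
    rw [div_le_one (norm_pos_iff.2 (hne y hy)), ← sq_le_sq₀ (norm_nonneg _) (norm_nonneg _),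
      ← Complex.normSq_eq_norm_sq, ← Complex.normSq_eq_norm_sq, Complex.normSq_apply,
      Complex.normSq_apply]
    simp only [Complex.sub_re, Complex.sub_im, Complex.add_re, Complex.add_im, Complex.conj_re,
      Complex.conj_im]
    nlinarith [mul_nonneg (hre y hy) h0.le]
  have key := Complex.dist_le_div_mul_dist_of_mapsTo_ball
    (f := fun y => (h y - h 0) / (h y + conj (h 0))) (by
      simp only [div_eq_mul_inv]
      exact (hd.sub_const (h 0)).mul ((hd.add_const _).inv hne)) hmaps hz
  simp only [sub_self, zero_div, dist_zero_right, norm_div] at key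
  rw [div_le_iff₀ (norm_pos_iff.2 (hne z hz))] at key
  simpa using key

/-- Harnack's inequality at the centre of the unit disc. -/
theorem re_mul_one_sub_le_re_mul_one_add {h : ℂ → ℂ} (hd : DifferentiableOn ℂ h (ball 0 1))
    (hre : ∀ z ∈ ball (0 : ℂ) 1, 0 ≤ (h z).re) (h0 : 0 < (h 0).re) {z : ℂ} (hz : z ∈ ball 0 1) :
    (h 0).re * (1 - ‖z‖) ≤ (h z).re * (1 + ‖z‖) := by
  have key := norm_sub_le_norm_mul_norm_add_conj hd hre h0 hz
  have hz1 := mem_ball_zero_iff.1 hz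
  have h2 : ‖h z - h 0‖ ^ 2 ≤ ‖z‖ ^ 2 * ‖h z + conj (h 0)‖ ^ 2 := by
    rw [← mul_pow]; exact pow_le_pow_left₀ (norm_nonneg _) key 2
  rw [← Complex.normSq_eq_norm_sq, ← Complex.normSq_eq_norm_sq (h z + _), Complex.normSq_apply,
      Complex.normSq_apply] at h2
  simp only [Complex.sub_re, Complex.sub_im, Complex.add_re, Complex.add_im, Complex.conj_re,
      Complex.conj_im] at h2
  have hzsq : ‖z‖ ^ 2 ≤ 1 := pow_le_one₀ (norm_nonneg _) hz1.le
  -- The two sides of `h2` contain the same imaginary part, with weights `1` and `‖z‖² ≤ 1`, so it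
  -- can be dropped.
  have h3 : ((h z).re - (h 0).re) ^ 2 ≤ (‖z‖ * ((h z).re + (h 0).re)) ^ 2 := by
    nlinarith [mul_nonneg (sub_nonneg.2 hzsq) (mul_self_nonneg ((h z).im - (h 0).im))]
  have h4 := abs_le_of_sq_le_sq h3
    (mul_nonneg (norm_nonneg _) (add_nonneg (hre z hz) h0.le))
  linarith [(abs_le.1 h4).1]

/-- Growth of holomorphic functions with nonnegative real part on the unit disc. -/
theorem norm_mul_one_sub_le_norm_mul_one_add {h : ℂ → ℂ} (hd : DifferentiableOn ℂ h (ball 0 1))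
    (hre : ∀ z ∈ ball (0 : ℂ) 1, 0 ≤ (h z).re) (h0 : 0 < (h 0).re) {z : ℂ} (hz : z ∈ ball 0 1) :
    ‖h z‖ * (1 - ‖z‖) ≤ ‖h 0‖ * (1 + ‖z‖) := by
  have key := norm_sub_le_norm_mul_norm_add_conj hd hre h0 hz
  have h1 := norm_sub_norm_le (h z) (h 0)
  have h2 : ‖h z + conj (h 0)‖ ≤ ‖h z‖ + ‖h 0‖ := by
    simpa only [RCLike.norm_conj] using norm_add_le (h z) (conj (h 0))
  have h3 := mul_le_mul_of_nonneg_left h2 (norm_nonneg z)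
  linarith

end Harnack

/-! ### Numerical range and bounds along complex lines -/

section NumericalRange

variable {X : Type*} [NormedAddCommGroup X] [NormedSpace ℂ X]

theorem neg_supportFunction_pi_le {A : X →L[ℂ] X} {u : X} (hu : ‖u‖ = 1) {φ : X →L[ℂ] ℂ}
    (hφ : φ ∈ supportFunctionals u) : -supportFunction A Real.pi ≤ (φ (A u)).re := by
  have hexp : Complex.exp (-(Complex.I * (Real.pi : ℂ))) = -1 := by
    rw [mul_comm, Complex.exp_neg, Complex.exp_pi_mul_I]; norm_num
  -- A real `sSup` is an upper bound only for a set that is bounded above; here `‖A‖` bounds it.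
  have hbdd : BddAbove ((fun w : ℂ => (Complex.exp (-(Complex.I * (Real.pi : ℂ))) * w).re) ''
      numericalRange A) := by
    refine ⟨‖A‖, ?_⟩
    rintro _ ⟨_, ⟨x, hx, ψ, hψ, rfl⟩, rfl⟩
    have hx1 := mem_sphere_zero_iff_norm.1 hx
    simp only [hexp, neg_one_mul]
    refine (Complex.re_le_norm _).trans ?_
    rw [norm_neg]
    refine (norm_apply_le_of_mem_supportFunctionals hψ _).trans ?_
    rw [hx1, one_mul]
    simpa [hx1] using A.le_opNorm x
  have := le_csSup hbdd (mem_image_of_mem _ ⟨u, mem_sphere_zero_iff_norm.2 hu, φ, hφ, rfl⟩)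
  simp only [hexp, neg_one_mul, Complex.neg_re] at this
  unfold supportFunction
  simp only [hexp, neg_one_mul, Complex.neg_re]
  linarith

/-- On the zero space the numerical range is empty and its `sSup` is `0` by convention, which is not
negative. -/
theorem StronglyAccretive.nontrivial {A : X →L[ℂ] X} (hA : StronglyAccretive A) :
    Nontrivial X := by
  by_contra h
  rw [not_nontrivial_iff_subsingleton] at h
  have hempty : numericalRange A = ∅ := by
    refine eq_empty_of_forall_notMem ?_
    rintro _ ⟨x, hx, -⟩
    simp [Subsingleton.elim x 0] at hx
  rw [StronglyAccretive, supportFunction, hempty, image_empty, Real.sSup_empty] at hA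
  exact lt_irrefl _ hA

variable {a : ℝ} {f : X → X}

/-- The slice function `ζ ↦ ⟨f(ζ u), φ⟩ / ζ` has nonnegative real part. -/
theorem ClassN.exists_slice (ha : 0 ≤ a) (hf : ClassN a f)
    (hA : StronglyAccretive (fderiv ℂ f 0)) {u : X} (hu : ‖u‖ = 1) {φ : X →L[ℂ] ℂ}
    (hφ : φ ∈ supportFunctionals u) : ∃ h : ℂ → ℂ, DifferentiableOn ℂ h (ball 0 1) ∧
      (∀ z ∈ ball (0 : ℂ) 1, 0 ≤ (h z).re) ∧ h 0 = φ (fderiv ℂ f 0 u) ∧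
      ∀ z ≠ 0, h z = φ (f (z • u)) / z := by
  have hmem : ∀ z ∈ ball (0 : ℂ) 1, z • u ∈ ball (0 : X) 1 := fun z hz => by
    rw [mem_ball_zero_iff] at hz ⊢
    rwa [norm_smul, hu, mul_one]
  have h0 : (0 : ℂ) ∈ ball (0 : ℂ) 1 := mem_ball_self one_pos
  set F : ℂ → ℂ := fun z => φ (f (z • u)) with hF
  have hFd : DifferentiableOn ℂ F (ball 0 1) :=
    φ.differentiable.comp_differentiableOn
      (hf.holo.comp (f := fun z : ℂ => z • u) (by fun_prop) hmem)
  have hF0 : F 0 = 0 := by simp [hF, hf.map_zero]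
  have hder : deriv F 0 = φ (fderiv ℂ f 0 u) := by
    have h1 : HasFDerivAt f (fderiv ℂ f 0) ((0 : ℂ) • u) := by
      rw [zero_smul]
      exact (hf.holo.differentiableAt (isOpen_ball.mem_nhds (mem_ball_self one_pos))).hasFDerivAt
    have h2 : HasDerivAt (fun z : ℂ => z • u) u 0 := by
      simpa using (hasDerivAt_id (0 : ℂ)).smul_const u
    exact (φ.hasFDerivAt.comp_hasDerivAt (0 : ℂ) (h1.comp_hasDerivAt (0 : ℂ) h2)).deriv
  have hval : ∀ z ≠ 0, dslope F 0 z = φ (f (z • u)) / z := fun z hz => by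
    rw [dslope_of_ne _ hz, slope_def_field, hF0, sub_zero, sub_zero]
  have hval0 : dslope F 0 0 = φ (fderiv ℂ f 0 u) := by rw [dslope_same, hder]
  refine ⟨dslope F 0, (Complex.differentiableOn_dslope (isOpen_ball.mem_nhds h0)).2 hFd,
    fun z hz => ?_, hval0, hval⟩
  -- At `0` the removable singularity takes the value `φ(f'(0)u)`, and strong accretivity applies.
  -- Elsewhere `conj z • φ` supports `z • u`, and the positive factor `|z|²` cancels.
  obtain rfl | hz0 := eq_or_ne z 0
  · rw [hval0]
    exact (neg_pos.2 hA).le.trans (neg_supportFunction_pi_le hu hφ)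
  · have h1 := hf.accretive _ (hmem z hz) _ (smul_mem_supportFunctionals hφ z)
    have h2 : (conj z • φ) (f (z • u)) = ((Complex.normSq z : ℝ) : ℂ) * dslope F 0 z := by
      rw [hval z hz0, Complex.normSq_eq_conj_mul_self, _root_.smul_apply, smul_eq_mul]
      field_simp
    rw [h2, Complex.re_ofReal_mul] at h1
    have h3 : 0 ≤ Complex.normSq z * (dslope F 0 z).re := (mul_nonneg ha (sq_nonneg _)).trans h1
    exact nonneg_of_mul_nonneg_right h3 (Complex.normSq_pos.2 hz0)

/-- Two-sided bounds on `⟨f(w), ψ⟩` for `ψ ∈ J(w)`. -/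
theorem ClassN.bounds (ha : 0 ≤ a) (hf : ClassN a f)
    (hA : StronglyAccretive (fderiv ℂ f 0)) {w : X} (hw : w ∈ ball 0 1) {ψ : X →L[ℂ] ℂ}
    (hψ : ψ ∈ supportFunctionals w) :
    -K f * ‖w‖ ^ 2 * (1 - ‖w‖) ≤ (ψ (f w)).re * (1 + ‖w‖) ∧
      ‖ψ (f w)‖ * (1 - ‖w‖) ≤ ‖fderiv ℂ f 0‖ * ‖w‖ ^ 2 * (1 + ‖w‖) := by
  obtain rfl | hw0 := eq_or_ne w 0
  · simp [hf.map_zero]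
  set t := ‖w‖ with ht
  have ht0 : 0 < t := norm_pos_iff.2 hw0
  have htc : (t : ℂ) ≠ 0 := Complex.ofReal_ne_zero.2 ht0.ne'
  set u := ((t : ℂ)⁻¹) • w with hu
  have hu1 : ‖u‖ = 1 := by
    rw [hu, norm_smul, norm_inv, Complex.norm_real, Real.norm_of_nonneg ht0.le]
    exact inv_mul_cancel₀ ht0.ne'
  have htu : (t : ℂ) • u = w := by rw [hu, smul_inv_smul₀ htc]
  have hφ := smul_mem_supportFunctionals hψ (t : ℂ)⁻¹
  obtain ⟨h, hd, hre, h0, hval⟩ := hf.exists_slice ha hA hu1 hφ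
  have ht1 : (t : ℂ) ∈ ball (0 : ℂ) 1 := by
    rw [mem_ball_zero_iff, Complex.norm_real, Real.norm_of_nonneg ht0.le]
    exact mem_ball_zero_iff.1 hw
  have hnorm : ‖(t : ℂ)‖ = t := by rw [Complex.norm_real, Real.norm_of_nonneg ht0.le]
  have hψt : ψ (f w) = ((t ^ 2 : ℝ) : ℂ) * h t := by
    rw [hval _ htc, htu, _root_.smul_apply, map_inv₀, Complex.conj_ofReal, smul_eq_mul]
    push_cast
    field_simp
  have hk : -K f ≤ (h 0).re := h0 ▸ neg_supportFunction_pi_le hu1 hφ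
  have hpos : 0 < (h 0).re := (neg_pos.2 hA).trans_le hk
  have h0n : ‖h 0‖ ≤ ‖fderiv ℂ f 0‖ := by
    rw [h0]
    refine (norm_apply_le_of_mem_supportFunctionals hφ _).trans ?_
    rw [hu1, one_mul]
    simpa [hu1] using (fderiv ℂ f 0).le_opNorm u
  have b1 := re_mul_one_sub_le_re_mul_one_add hd hre hpos ht1
  have b2 := norm_mul_one_sub_le_norm_mul_one_add hd hre hpos ht1
  rw [hnorm] at b1 b2
  have hlt : t < 1 := mem_ball_zero_iff.1 hw
  rw [hψt, Complex.re_ofReal_mul, norm_mul, Complex.norm_real, Real.norm_of_nonneg (sq_nonneg t)]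
  constructor
  · calc _ = t ^ 2 * (-K f * (1 - t)) := by ring
      _ ≤ t ^ 2 * ((h t).re * (1 + t)) := by
        refine mul_le_mul_of_nonneg_left (le_trans ?_ b1) (sq_nonneg t)
        exact mul_le_mul_of_nonneg_right hk (by linarith)
      _ = _ := by ring
  · calc _ = t ^ 2 * (‖h t‖ * (1 - t)) := by ring
      _ ≤ t ^ 2 * (‖fderiv ℂ f 0‖ * (1 + t)) := by
        refine mul_le_mul_of_nonneg_left (b2.trans ?_) (sq_nonneg t)
        exact mul_le_mul_of_nonneg_right h0n (by linarith)
      _ = _ := by ring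

end NumericalRange

/-! ### Homogeneous Taylor terms and boundedness on smaller balls -/

section Taylor

variable {X : Type*} [NormedAddCommGroup X] [NormedSpace ℂ X]

/-- The `n`-th homogeneous Taylor polynomial of `f` at `0`. -/
noncomputable def taylorTerm (f : X → X) (n : ℕ) (u : X) : X :=
  (n.factorial : ℂ)⁻¹ • iteratedDeriv n (fun z : ℂ => f (z • u)) 0

variable {f : X → X}

theorem differentiableOn_slice (hf : DifferentiableOn ℂ f (ball 0 1)) (u : X) :
    DifferentiableOn ℂ (fun z : ℂ => f (z • u)) {z | ‖z • u‖ < 1} :=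
  hf.comp (f := fun z : ℂ => z • u) (by fun_prop) fun _ hz => mem_ball_zero_iff.2 hz

variable [CompleteSpace X]

theorem hasSum_taylorTerm (hf : DifferentiableOn ℂ f (ball 0 1)) {u : X} (hu : ‖u‖ < 1) {z : ℂ}
    (hz : ‖z‖ ≤ 1) : HasSum (fun n => z ^ n • taylorTerm f n u) (f (z • u)) := by
  -- A disc of radius larger than `1` on which `z • u` stays in the unit ball, so that `z = 1` is
  -- interior.
  have hR : 1 < 2 / (1 + ‖u‖) := by
    rw [lt_div_iff₀ (by positivity)]; linarith
  have hRu : 2 / (1 + ‖u‖) * ‖u‖ ≤ 1 := by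
    rw [div_mul_eq_mul_div, div_le_one (by positivity)]; linarith
  have hd : DifferentiableOn ℂ (fun z : ℂ => f (z • u)) (ball 0 (2 / (1 + ‖u‖))) := by
    refine (differentiableOn_slice hf u).mono fun y hy => ?_
    rw [mem_ball_zero_iff] at hy
    rw [mem_ofPred_eq, norm_smul]
    obtain hu0 | hu0 := (norm_nonneg u).eq_or_lt
    · rw [← hu0]; simp
    · exact (mul_lt_mul_of_pos_right hy hu0).trans_le hRu
  have := Complex.hasSum_taylorSeries_on_ball hd (z := z)
    (mem_ball_zero_iff.2 (hz.trans_lt hR))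
  simp only [sub_zero] at this
  convert this using 2 with n
  rw [taylorTerm, smul_comm]

theorem norm_taylorTerm_le (hf : DifferentiableOn ℂ f (ball 0 1)) {δ C : ℝ} (hδ : 0 < δ)
    (hδ1 : δ < 1) (hC : ∀ x ∈ closedBall (0 : X) δ, ‖f x‖ ≤ C) {u : X} (hu : ‖u‖ ≤ 1) (n : ℕ) :
    ‖taylorTerm f n u‖ ≤ C / δ ^ n := by
  have hsub : ∀ z ∈ closedBall (0 : ℂ) δ, ‖z • u‖ ≤ δ := fun z hz => by
    rw [norm_smul]
    exact (mul_le_of_le_one_right (norm_nonneg _) hu).trans (mem_closedBall_zero_iff.1 hz)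
  have := Complex.norm_iteratedDeriv_le_of_forall_mem_sphere_norm_le n hδ
    ((differentiableOn_slice hf u).diffContOnCl_ball (c := 0) (R := δ)
      fun z hz => (hsub z hz).trans_lt hδ1)
    (fun z hz => hC _ (mem_closedBall_zero_iff.2 (hsub z (sphere_subset_closedBall hz))))
  have hn : (0 : ℝ) < n.factorial := Nat.cast_pos.2 n.factorial_pos
  rw [taylorTerm, norm_smul, norm_inv, Complex.norm_natCast, inv_mul_le_iff₀ hn, ← mul_div_assoc]
  exact this

/-- The Taylor polynomials of a holomorphic map that is bounded near `0` are holomorphic. -/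
theorem differentiableOn_taylorTerm (hf : DifferentiableOn ℂ f (ball 0 1)) {δ C : ℝ} (hδ : 0 < δ)
    (hδ1 : δ < 1) (hC : ∀ x ∈ closedBall (0 : X) δ, ‖f x‖ ≤ C) (n : ℕ) :
    DifferentiableOn ℂ (taylorTerm f n) (ball 0 1) := by
  induction n using Nat.strong_induction_on with
  | _ n ih =>
  have hC0 : 0 ≤ C := (norm_nonneg _).trans (hC 0 (mem_closedBall_self hδ.le))
  set x : ℕ → ℝ := fun j => 1 / (2 * ((j : ℝ) + 1)) with hx
  have hx0 : ∀ j, 0 < x j := fun j => by positivity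
  have hx2 : ∀ j, x j ≤ 1 / 2 := fun j => by
    refine one_div_le_one_div_of_le two_pos ?_
    linarith [(Nat.cast_nonneg j : (0 : ℝ) ≤ j)]
  set t : ℕ → ℝ := fun j => δ * x j with ht
  have ht0 : ∀ j, 0 < t j := fun j => mul_pos hδ (hx0 j)
  have ht1 : ∀ j, t j ≤ 1 := fun j => by
    have := mul_le_mul hδ1.le (hx2 j) (hx0 j).le one_pos.le
    linarith
  -- The Taylor remainder of order `n`, rescaled by `t j → 0`, tends to the `n`-th term uniformly in
  -- `u`. The bound `x j ≤ 1 / 2` keeps the geometric tail within a factor `2`.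
  set F : ℕ → X → X := fun j u =>
    ((t j : ℂ) ^ n)⁻¹ • (f ((t j : ℂ) • u) - ∑ k ∈ Finset.range n, (t j : ℂ) ^ k • taylorTerm f k u)
    with hF
  have htn : ∀ j, ‖(t j : ℂ)‖ = t j := fun j => by
    rw [Complex.norm_real, Real.norm_of_nonneg (ht0 j).le]
  have hFd : ∀ j, DifferentiableOn ℂ (F j) (ball 0 1) := fun j => by
    refine DifferentiableOn.const_smul (DifferentiableOn.sub ?_ ?_) _
    · refine hf.comp (f := fun u => (t j : ℂ) • u) (by fun_prop) fun u hu => ?_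
      rw [mem_ball_zero_iff] at hu ⊢
      rw [norm_smul, htn]
      exact (mul_le_of_le_one_left (norm_nonneg _) (ht1 j)).trans_lt hu
    · exact DifferentiableOn.fun_sum fun k hk => (ih k (Finset.mem_range.1 hk)).const_smul _
  have hbound : ∀ j, ∀ u ∈ ball (0 : X) 1, ‖F j u - taylorTerm f n u‖ ≤ 2 * C / δ ^ n * x j := by
    intro j u hu
    have hu1 := mem_ball_zero_iff.1 hu
    have hsum := (hasSum_nat_add_iff' (n + 1)).2
      (hasSum_taylorTerm hf hu1 (z := (t j : ℂ)) (by rw [htn]; exact ht1 j))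
    have hgeo : HasSum (fun m : ℕ => C * x j ^ (n + 1) * x j ^ m)
        (C * x j ^ (n + 1) * (1 - x j)⁻¹) :=
      (hasSum_geometric_of_lt_one (hx0 j).le (by linarith [hx2 j])).mul_left _
    have hle := hsum.norm_le_of_bounded hgeo fun m => by
      rw [norm_smul, norm_pow, htn]
      calc t j ^ (m + (n + 1)) * ‖taylorTerm f (m + (n + 1)) u‖
          ≤ t j ^ (m + (n + 1)) * (C / δ ^ (m + (n + 1))) :=
            mul_le_mul_of_nonneg_left (norm_taylorTerm_le hf hδ hδ1 hC hu1.le _)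
              (pow_nonneg (ht0 j).le _)
        _ = C * x j ^ (n + 1) * x j ^ m := by
            rw [ht]; simp only [mul_pow]; field_simp; ring
    have hFeq : F j u - taylorTerm f n u = ((t j : ℂ) ^ n)⁻¹ • (f ((t j : ℂ) • u) -
        ∑ k ∈ Finset.range (n + 1), (t j : ℂ) ^ k • taylorTerm f k u) := by
      rw [Finset.sum_range_succ, ← sub_sub, smul_sub _ _ ((t j : ℂ) ^ n • taylorTerm f n u),
        inv_smul_smul₀ (pow_ne_zero _ (Complex.ofReal_ne_zero.2 (ht0 j).ne'))]
    have hinv : (1 - x j)⁻¹ ≤ 2 := by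
      rw [inv_le_comm₀ (by linarith [hx2 j]) two_pos]
      linarith [hx2 j]
    rw [hFeq, norm_smul, norm_inv, norm_pow, htn, inv_mul_le_iff₀ (pow_pos (ht0 j) n)]
    calc _ ≤ _ := hle
      _ ≤ C * x j ^ (n + 1) * 2 :=
          mul_le_mul_of_nonneg_left hinv (mul_nonneg hC0 (pow_nonneg (hx0 j).le _))
      _ = _ := by rw [ht]; simp only [mul_pow]; field_simp; ring
  refine differentiableOn_of_tendstoUniformlyOn isOpen_ball hFd ?_
  have hxlim : Tendsto (fun j => 2 * C / δ ^ n * x j) atTop (𝓝 0) := by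
    have h1 : Tendsto (fun j : ℕ => 1 / 2 * (1 / ((j : ℝ) + 1))) atTop (𝓝 (1 / 2 * 0)) :=
      tendsto_one_div_add_atTop_nhds_zero_nat.const_mul _
    have h2 := h1.const_mul (2 * C / δ ^ n)
    simp only [mul_zero] at h2
    refine h2.congr fun j => ?_
    rw [hx]; simp only; field_simp
  rw [Metric.tendstoUniformlyOn_iff]
  intro ε hε
  filter_upwards [hxlim.eventually_lt_const hε] with j hj u hu
  rw [dist_comm, dist_eq_norm]
  exact (hbound j u hu).trans_lt hj

/-- Cauchy's estimate for `z ↦ ψ(f(z • w))` on the circle `|z| = r / ‖w‖`: there `‖z • w‖ = r` and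
`conj z • ψ` is a support functional at `z • w`. -/
theorem norm_supportFunctional_taylorTerm_le (hf : DifferentiableOn ℂ f (ball 0 1)) {r m : ℝ}
    (hr : 0 < r) (hr1 : r < 1)
    (hm : ∀ v ∈ closedBall (0 : X) r, ∀ φ ∈ supportFunctionals v, ‖φ (f v)‖ ≤ m * ‖v‖ ^ 2)
    {w : X} {ψ : X →L[ℂ] ℂ} (hψ : ψ ∈ supportFunctionals w) (n : ℕ) :
    ‖ψ (taylorTerm f n w)‖ ≤ m * r * ‖w‖ * (‖w‖ / r) ^ n := by
  obtain rfl | hw0 := eq_or_ne w 0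
  · have : ‖ψ‖ = 0 := by rw [norm_eq_of_mem_supportFunctionals hψ, norm_zero]
    rw [norm_eq_zero.1 this]
    simp
  have hw : 0 < ‖w‖ := norm_pos_iff.2 hw0
  set R := r / ‖w‖ with hRdef
  have hR : 0 < R := div_pos hr hw
  have hRw : R * ‖w‖ = r := div_mul_cancel₀ _ hw.ne'
  have hd := differentiableOn_slice hf w
  have hsub : closedBall (0 : ℂ) R ⊆ {z | ‖z • w‖ < 1} := fun z hz => by
    rw [mem_ofPred_eq, norm_smul]
    refine lt_of_le_of_lt ?_ hr1
    rw [← hRw]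
    exact mul_le_mul_of_nonneg_right (mem_closedBall_zero_iff.1 hz) hw.le
  have hcomm : ψ (iteratedDeriv n (fun z : ℂ => f (z • w)) 0) =
      iteratedDeriv n (fun z : ℂ => ψ (f (z • w))) 0 := by
    have hc : ContDiffAt ℂ n (fun z : ℂ => f (z • w)) 0 :=
      (hd.analyticAt (mem_of_superset (closedBall_mem_nhds 0 hR) hsub)).contDiffAt
    have := ψ.iteratedFDeriv_comp_left hc le_rfl
    rw [iteratedDeriv_eq_iteratedFDeriv, iteratedDeriv_eq_iteratedFDeriv]
    exact (congrArg (fun M => M fun _ => (1 : ℂ)) this).symm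
  have hcau := Complex.norm_iteratedDeriv_le_of_forall_mem_sphere_norm_le (C := m * r * ‖w‖) n hR
    ((ψ.differentiable.comp_differentiableOn hd).diffContOnCl_ball hsub) fun z hz => by
      have hzR := mem_sphere_zero_iff_norm.1 hz
      have hzw : ‖z • w‖ = r := by rw [norm_smul, hzR, hRw]
      have h1 := hm (z • w) (mem_closedBall_zero_iff.2 hzw.le) _ (smul_mem_supportFunctionals hψ z)
      rw [_root_.smul_apply, norm_smul, RCLike.norm_conj, hzR, hzw] at h1
      refine le_of_mul_le_mul_left (h1.trans_eq ?_) hR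
      calc m * r ^ 2 = m * r * (R * ‖w‖) := by rw [hRw]; ring
        _ = _ := by ring
  have hn : (0 : ℝ) < n.factorial := Nat.cast_pos.2 n.factorial_pos
  rw [taylorTerm, map_smul, norm_smul, norm_inv, Complex.norm_natCast, inv_mul_le_iff₀ hn, hcomm]
  refine hcau.trans_eq ?_
  rw [hRdef, div_pow, div_pow]
  field_simp

variable {a : ℝ}

/-- A map of class `N_a` with strongly accretive derivative is bounded on smaller balls. -/
theorem ClassN.exists_forall_ball_norm_le (ha : 0 ≤ a) (hf : ClassN a f)
    (hA : StronglyAccretive (fderiv ℂ f 0)) {r : ℝ} (hr : r < 1) :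
    ∃ C, ∀ x ∈ ball (0 : X) r, ‖f x‖ ≤ C := by
  -- Radii `r < s < s' < R < 1`: the pairings with `f` are bounded up to `R`, those with the Taylor
  -- terms are used up to `s'`, and `s` leaves room around `x`. The maximum with `0` covers
  -- nonpositive `r`.
  obtain ⟨s, hs, hs1⟩ := exists_between (max_lt hr one_pos)
  have hrs : r < s := (le_max_left _ _).trans_lt hs
  have hs0 : 0 < s := (le_max_right _ _).trans_lt hs
  obtain ⟨s', hs', hs'1⟩ := exists_between hs1
  obtain ⟨R, hR, hR1⟩ := exists_between hs'1
  have hs'0 : 0 < s' := hs0.trans hs'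
  have hR0 : 0 < R := hs'0.trans hR
  obtain ⟨δ, C, hδ, hδ1, hC⟩ : ∃ δ C : ℝ, 0 < δ ∧ δ < 1 ∧
      ∀ x ∈ closedBall (0 : X) δ, ‖f x‖ ≤ C := by
    have hcont : ContinuousAt f 0 :=
      hf.holo.continuousOn.continuousAt (isOpen_ball.mem_nhds (mem_ball_self one_pos))
    obtain ⟨ε, hε, hball⟩ := Metric.eventually_nhds_iff_ball.1
      (hcont.norm.eventually_lt_const (u := 1) (by simp [hf.map_zero]))
    refine ⟨min (ε / 2) (1 / 2), 1, lt_min (half_pos hε) one_half_pos,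
      (min_le_right _ _).trans_lt one_half_lt_one, fun x hx => (hball x ?_).le⟩
    exact closedBall_subset_ball ((min_le_left _ _).trans_lt (half_lt_self hε)) hx
  -- The summand `1` only ensures `m > 0`, since a positive constant `c` is required later.
  set m := ‖fderiv ℂ f 0‖ * (1 + R) / (1 - R) + 1 with hm
  have hm0 : 0 < m := by
    have : 0 < 1 - R := by linarith
    positivity
  have hnum : ∀ v ∈ closedBall (0 : X) R, ∀ φ ∈ supportFunctionals v,
      ‖φ (f v)‖ ≤ m * ‖v‖ ^ 2 := by
    intro v hv φ hφ
    have hvR := mem_closedBall_zero_iff.1 hv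
    have h1 := (hf.bounds ha hA (closedBall_subset_ball hR1 hv) hφ).2
    have hR' : 0 < 1 - R := by linarith
    have h2 : ‖φ (f v)‖ * (1 - R) ≤ ‖fderiv ℂ f 0‖ * ‖v‖ ^ 2 * (1 + R) := by
      refine le_trans ?_ (h1.trans ?_) <;> gcongr
    have h3 : ‖φ (f v)‖ ≤ ‖fderiv ℂ f 0‖ * (1 + R) / (1 - R) * ‖v‖ ^ 2 := by
      rw [div_mul_eq_mul_div, le_div_iff₀ hR']
      linarith
    rw [hm, add_mul, one_mul]
    linarith [sq_nonneg ‖v‖]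
  have hq1 : s' / R < 1 := (div_lt_one hR0).2 hR
  have hgeo : HasSum (fun n : ℕ => 4 * s * (m * R) / (s - r) * (s' / R) ^ n)
      (4 * s * (m * R) / (s - r) * (1 - s' / R)⁻¹) :=
    (hasSum_geometric_of_lt_one (by positivity) hq1).mul_left _
  refine ⟨4 * s * (m * R) / (s - r) * (1 - s' / R)⁻¹, fun x hx => ?_⟩
  have hxr := mem_ball_zero_iff.1 hx
  have hsum : HasSum (fun n => taylorTerm f n x) (f x) := by
    simpa using hasSum_taylorTerm hf.holo (hxr.trans hr) (z := 1) (by simp)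
  refine hsum.norm_le_of_bounded hgeo fun n => ?_
  have hsub : ball (0 : X) s' ⊆ ball 0 1 := ball_subset_ball hs'1.le
  have := norm_apply_le_of_norm_supportFunctional_le (c := m * R * (s' / R) ^ n) hs'
    ((differentiableOn_taylorTerm hf.holo hδ hδ1 hC n).mono hsub)
    (fun w hw => norm_taylorTerm_le hf.holo hδ hδ1 hC (mem_ball_zero_iff.1 (hsub hw)).le n)
    (by positivity)
    (fun w hw ψ hψ => by
      refine (norm_supportFunctional_taylorTerm_le hf.holo hR0 hR1 hnum hψ n).trans ?_
      rw [mul_right_comm]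
      have := (mem_ball_zero_iff.1 hw).le
      gcongr) (hxr.trans hrs)
  refine this.trans ?_
  calc _ ≤ 4 * s * (m * R * (s' / R) ^ n) / (s - r) := by
        have : 0 < s - r := by linarith
        gcongr
    _ = _ := by ring

end Taylor

/-! ### The resolvent: estimates, image and existence -/

section Resolvent

variable {X : Type*} [NormedAddCommGroup X] [NormedSpace ℂ X] {a l : ℝ} {f : X → X}

theorem norm_sq_add_mul_re_le {w x : X}
    (hx : w + (l : ℂ) • f w = x) {ψ : X →L[ℂ] ℂ} (hψ : ψ ∈ supportFunctionals w) :
    ‖w‖ ^ 2 + l * (ψ (f w)).re ≤ ‖w‖ * ‖x‖ := by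
  have h1 := re_apply_le_of_mem_supportFunctionals hψ x
  rwa [← hx, map_add, map_smul, smul_eq_mul, Complex.add_re, Complex.re_ofReal_mul,
    re_apply_self_of_mem_supportFunctionals hψ, hx] at h1

theorem ClassN.one_add_mul_norm_le (hf : ClassN a f) (hl : 0 < l) {w x : X} (hw : w ∈ ball 0 1)
    (hx : w + (l : ℂ) • f w = x) : (1 + l * a) * ‖w‖ ≤ ‖x‖ := by
  obtain hw0 | hw0 := (norm_nonneg w).eq_or_lt
  · rw [← hw0, mul_zero]; exact norm_nonneg x
  obtain ⟨ψ, hψ⟩ := supportFunctionals_nonempty w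
  have h1 := norm_sq_add_mul_re_le hx hψ
  have h2 := mul_le_mul_of_nonneg_left (hf.accretive w hw ψ hψ) hl.le
  refine le_of_mul_le_mul_left ?_ hw0
  nlinarith

theorem ClassN.norm_le_of_resolvent_eq (ha : 0 ≤ a) (hf : ClassN a f) (hl : 0 < l) {w x : X}
    (hw : w ∈ ball 0 1) (hx : w + (l : ℂ) • f w = x) : ‖w‖ ≤ ‖x‖ := by
  have h1 := hf.one_add_mul_norm_le hl hw hx
  have h2 : 0 ≤ l * a * ‖w‖ := by positivity
  linarith

theorem ClassN.norm_mul_le_norm_mul (ha : 0 ≤ a) (hf : ClassN a f)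
    (hA : StronglyAccretive (fderiv ℂ f 0)) (hl : 0 < l) {w x : X} (hw : w ∈ ball 0 1)
    (hx : w + (l : ℂ) • f w = x) :
    ‖w‖ * ((1 + ‖w‖) + l * -K f * (1 - ‖w‖)) ≤ ‖x‖ * (1 + ‖w‖) := by
  obtain hw0 | hw0 := (norm_nonneg w).eq_or_lt
  · rw [← hw0, zero_mul]; simp
  obtain ⟨ψ, hψ⟩ := supportFunctionals_nonempty w
  have h1 := mul_le_mul_of_nonneg_right (norm_sq_add_mul_re_le hx hψ)
    (by positivity : 0 ≤ 1 + ‖w‖)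
  have h2 := mul_le_mul_of_nonneg_left (hf.bounds ha hA hw hψ).1 hl.le
  refine le_of_mul_le_mul_left ?_ hw0
  nlinarith

theorem alpha_pos (ha : 0 ≤ a) (hA : StronglyAccretive (fderiv ℂ f 0)) (hl : 0 < l) :
    0 < alpha a f l := by
  have hK : K f < 0 := hA
  refine lt_min (div_pos three_pos ?_) (by positivity)
  nlinarith

theorem alpha_le_one (ha : 0 ≤ a) (hl : 0 < l) : alpha a f l ≤ 1 := by
  refine (min_le_right _ _).trans ?_
  rw [div_le_one (by positivity)]
  linarith [mul_nonneg hl.le ha]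

theorem ClassN.norm_le_alpha_mul (ha : 0 ≤ a) (hf : ClassN a f)
    (hA : StronglyAccretive (fderiv ℂ f 0)) (hl : 0 < l) {w x : X} (hw : w ∈ ball 0 1)
    (hx1 : ‖x‖ < 1) (hx : w + (l : ℂ) • f w = x) : ‖w‖ ≤ alpha a f l * ‖x‖ := by
  have hK : K f < 0 := hA
  have h1 := hf.one_add_mul_norm_le hl hw hx
  have h2 := hf.norm_mul_le_norm_mul ha hA hl hw hx
  have h3 := hf.norm_le_of_resolvent_eq ha hl hw hx
  have hw1 := mem_ball_zero_iff.1 hw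
  have hw0 := norm_nonneg w
  have hx0 := norm_nonneg x
  rw [alpha, min_mul_of_nonneg _ _ hx0]
  refine le_min ?_ ?_
  · obtain ⟨c, hc⟩ : ∃ c, c = l * -K f := ⟨_, rfl⟩
    have hc0 : 0 < c := hc ▸ mul_pos hl (neg_pos.2 hK)
    rw [show 1 - l * K f = 1 + c by rw [hc]; ring, div_mul_eq_mul_div, le_div_iff₀ (by linarith)]
    rw [← hc] at h2
    generalize ‖w‖ = t at *
    generalize ‖x‖ = y at *
    -- For `c ≤ 2` the bound `t ≤ y` suffices because `1 + c ≤ 3`; this is the source of the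
    -- constant `3`.
    obtain hc2 | hc2 := le_or_gt c 2
    · nlinarith
    -- Inserting `y < 1` into `h2` leaves an inequality that factors through `1 - t > 0`. The
    -- resulting bound on `t` gives `(1 + c)(1 + t) ≤ 3(1 + t + c(1 - t))`, which combines with
    -- `h2`.
    · have h4 : t * (c - 1) < 1 := by
        have h5 : (1 - t) * (1 - t * (c - 1)) > 0 := by nlinarith
        have := pos_of_mul_pos_right h5 (by linarith)
        linarith
      have h6 : t * (1 + c) * (1 + t) ≤ 3 * y * (1 + t) := by
        nlinarith [mul_nonneg hw0 (mul_nonneg (sub_nonneg.2 hc2.le) hw0)]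
      exact le_of_mul_le_mul_right h6 (by linarith)
  · rw [one_div, inv_mul_eq_div, le_div_iff₀ (by positivity)]
    linarith

theorem beta_nonneg : 0 ≤ beta a f l := ENNReal.toReal_nonneg

theorem norm_le_toReal_M {E : Type*} [NormedAddCommGroup E] {f : E → E} {r : ℝ}
    (hM : M f r ≠ ⊤) {y : E} (hy : y ∈ ball 0 r) : ‖f y‖ ≤ (M f r).toReal :=
  (ENNReal.ofReal_le_iff_le_toReal hM).1
    (le_iSup₂ (f := fun y (_ : y ∈ ball (0 : E) r) => ENNReal.ofReal ‖f y‖) y hy)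

theorem beta_eq_zero (hl : 0 < l) (hM : M f (alpha a f l) = ⊤) : beta a f l = 0 := by
  rw [beta, hM, ENNReal.mul_top (by simpa using hl), add_top, ENNReal.div_top,
    ENNReal.toReal_zero]

theorem beta_eq_div (hα : 0 ≤ alpha a f l) (hl : 0 < l) (hM : M f (alpha a f l) ≠ ⊤) :
    beta a f l = alpha a f l / (alpha a f l + l * (M f (alpha a f l)).toReal) := by
  rw [beta, ENNReal.toReal_div, ENNReal.toReal_add ENNReal.ofReal_ne_top
    (ENNReal.mul_ne_top ENNReal.ofReal_ne_top hM), ENNReal.toReal_mul,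
    ENNReal.toReal_ofReal hα, ENNReal.toReal_ofReal hl.le]

/-- Schwarz's lemma on the ball of radius `α` gives `‖f y‖ ≤ (M / α)‖y‖`, and `1 + l M / α = 1 / β`.
If `M` is infinite then `β = 0`. -/
theorem ClassN.beta_mul_le (ha : 0 ≤ a) (hf : ClassN a f)
    (hA : StronglyAccretive (fderiv ℂ f 0)) (hl : 0 < l) {y : X}
    (hy : y ∈ ball 0 (alpha a f l)) : beta a f l * (‖y‖ + l * ‖f y‖) ≤ ‖y‖ := by
  have hα := alpha_pos ha hA hl
  by_cases hM : M f (alpha a f l) = ⊤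
  · rw [beta_eq_zero hl hM, zero_mul]; exact norm_nonneg y
  rw [beta_eq_div hα.le hl hM]
  have hschwarz := Complex.dist_le_div_mul_dist_of_mapsTo_ball
    (hf.holo.mono (ball_subset_ball (alpha_le_one ha hl)))
    (R₂ := (M f (alpha a f l)).toReal) (fun z hz => by
      rw [hf.map_zero, mem_closedBall_zero_iff]
      exact norm_le_toReal_M hM hz) hy
  rw [hf.map_zero, dist_zero_right, dist_zero_right, div_mul_eq_mul_div, le_div_iff₀ hα]
    at hschwarz
  have hm : 0 ≤ (M f (alpha a f l)).toReal := ENNReal.toReal_nonneg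
  rw [div_mul_eq_mul_div, div_le_iff₀ (by positivity)]
  have := mul_le_mul_of_nonneg_left hschwarz hl.le
  linarith

theorem IsResolvent.norm_le_alpha_mul (ha : 0 ≤ a) (hf : ClassN a f)
    (hA : StronglyAccretive (fderiv ℂ f 0)) (hl : 0 < l) {g : X → X} (hg : IsResolvent f l g)
    {x : X} (hx : x ∈ ball 0 1) : ‖g x‖ ≤ alpha a f l * ‖x‖ :=
  hf.norm_le_alpha_mul ha hA hl (hg.mapsTo hx) (mem_ball_zero_iff.1 hx) (hg.eqn x hx)

theorem IsResolvent.mem_ball_alpha (ha : 0 ≤ a) (hf : ClassN a f)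
    (hA : StronglyAccretive (fderiv ℂ f 0)) (hl : 0 < l) {g : X → X} (hg : IsResolvent f l g)
    {x : X} (hx : x ∈ ball 0 1) : g x ∈ ball 0 (alpha a f l) :=
  mem_ball_zero_iff.2 ((hg.norm_le_alpha_mul ha hf hA hl hx).trans_lt
    (mul_lt_of_lt_one_right (alpha_pos ha hA hl) (mem_ball_zero_iff.1 hx)))

theorem IsResolvent.norm_le_norm_add (hl : 0 < l) {g : X → X} (hg : IsResolvent f l g)
    {x : X} (hx : x ∈ ball 0 1) : ‖x‖ ≤ ‖g x‖ + l * ‖f (g x)‖ := by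
  have := norm_add_le (g x) ((l : ℂ) • f (g x))
  rwa [hg.eqn x hx, norm_smul, Complex.norm_real, Real.norm_of_nonneg hl.le] at this

theorem IsResolvent.beta_mul_le (ha : 0 ≤ a) (hf : ClassN a f)
    (hA : StronglyAccretive (fderiv ℂ f 0)) (hl : 0 < l) {g : X → X} (hg : IsResolvent f l g)
    {x : X} (hx : x ∈ ball 0 1) : beta a f l * ‖x‖ ≤ ‖g x‖ :=
  (mul_le_mul_of_nonneg_left (hg.norm_le_norm_add hl hx) beta_nonneg).trans
    (hf.beta_mul_le ha hA hl (hg.mem_ball_alpha ha hf hA hl hx))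

/-- Equivalent, for finite `M`, to `1 ≤ α + l M`: points `x` of norm arbitrarily close to `1`
satisfy `x = g x + l f(g x)` with `g x` in the ball of radius `α`. -/
theorem IsResolvent.beta_le_alpha (ha : 0 ≤ a) (hf : ClassN a f)
    (hA : StronglyAccretive (fderiv ℂ f 0)) (hl : 0 < l) {g : X → X} (hg : IsResolvent f l g) :
    beta a f l ≤ alpha a f l := by
  have hα := alpha_pos ha hA hl
  by_cases hM : M f (alpha a f l) = ⊤
  · rw [beta_eq_zero hl hM]; exact hα.le
  rw [beta_eq_div hα.le hl hM]
  refine div_le_self hα.le (le_of_forall_lt_imp_le_of_dense fun c hc => ?_)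
  obtain hc0 | hc0 := lt_or_ge c 0
  · have hm : 0 ≤ (M f (alpha a f l)).toReal := ENNReal.toReal_nonneg
    exact hc0.le.trans (by positivity)
  have := hA.nontrivial
  obtain ⟨x, hxc⟩ := exists_norm_eq X hc0
  have hx : x ∈ ball (0 : X) 1 := mem_ball_zero_iff.2 (hxc ▸ hc)
  have hgα := hg.mem_ball_alpha ha hf hA hl hx
  calc c = ‖x‖ := hxc.symm
    _ ≤ ‖g x‖ + l * ‖f (g x)‖ := hg.norm_le_norm_add hl hx
    _ ≤ _ := add_le_add (mem_ball_zero_iff.1 hgα).le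
      (mul_le_mul_of_nonneg_left (norm_le_toReal_M hM hgα) hl.le)

/-- The preimage of `y` is explicit, `y + l f(y)`; its norm is at most `‖y‖ / β < 1`, and uniqueness
identifies `y` with its resolvent. -/
theorem IsResolvent.ball_beta_subset (ha : 0 ≤ a) (hf : ClassN a f)
    (hA : StronglyAccretive (fderiv ℂ f 0)) (hl : 0 < l) {g : X → X} (hg : IsResolvent f l g) :
    ball 0 (beta a f l) ⊆ g '' ball 0 1 := by
  intro y hy
  have hβ : 0 < beta a f l := nonempty_ball.1 ⟨y, hy⟩
  have hyα := ball_subset_ball (hg.beta_le_alpha ha hf hA hl) hy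
  have hx : y + (l : ℂ) • f y ∈ ball (0 : X) 1 := by
    rw [mem_ball_zero_iff]
    refine lt_of_mul_lt_mul_left ?_ hβ.le
    calc beta a f l * ‖y + (l : ℂ) • f y‖ ≤ beta a f l * (‖y‖ + l * ‖f y‖) := by
          gcongr
          refine (norm_add_le _ _).trans_eq ?_
          rw [norm_smul, Complex.norm_real, Real.norm_of_nonneg hl.le]
      _ ≤ ‖y‖ := hf.beta_mul_le ha hA hl hyα
      _ < beta a f l * 1 := by rw [mul_one]; exact mem_ball_zero_iff.1 hy
  exact ⟨_, hx, (hg.unique _ hx y (ball_subset_ball (alpha_le_one ha hl) hyα) rfl).symm⟩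

theorem tendstoUniformlyOn_resolvent (ha : 0 ≤ a) (hf : ClassN a f)
    (hA : StronglyAccretive (fderiv ℂ f 0)) {G : ℝ → X → X}
    (hG : ∀ l, 0 < l → IsResolvent f l (G l)) :
    TendstoUniformlyOn G (fun _ => 0) atTop (ball (0 : X) 1) := by
  have hK : 0 < -K f := neg_pos.2 hA
  have hlim : Tendsto (fun l : ℝ => 3 / (1 - l * K f)) atTop (𝓝 0) := by
    refine Tendsto.const_div_atTop ?_ 3
    simpa only [sub_eq_add_neg, mul_neg, id] using
      tendsto_atTop_add_const_left atTop 1 (tendsto_id.atTop_mul_const hK)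
  rw [Metric.tendstoUniformlyOn_iff]
  intro ε hε
  filter_upwards [hlim.eventually_lt_const hε, eventually_gt_atTop 0] with l hlε hl x hx
  rw [dist_zero_left]
  exact (mem_ball_zero_iff.1 ((hG l hl).mem_ball_alpha ha hf hA hl hx)).trans
    ((min_le_left _ _).trans_lt hlε)

variable [CompleteSpace X]

/-- The resolvent equation is uniquely and holomorphically solvable over smaller balls. -/
theorem ClassN.exists_resolvent_ball (ha : 0 ≤ a) (hf : ClassN a f)
    (hA : StronglyAccretive (fderiv ℂ f 0)) (hl : 0 < l) {r : ℝ} (hr : r ∈ Ioo (0 : ℝ) 1) :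
    ∃ g : X → X, DifferentiableOn ℂ g (ball 0 r) ∧ ∀ x ∈ ball (0 : X) r,
      g x ∈ ball 0 1 ∧ g x + (l : ℂ) • f (g x) = x ∧
      ∀ w ∈ ball 0 1, w + (l : ℂ) • f w = x → w = g x := by
  -- Radii `r < s < s' < s'' < 1`: `f` is bounded up to `s''`, hence Lipschitz up to `s'`, and zeros
  -- are sought within `s`.
  obtain ⟨s, hrs, hs1⟩ := exists_between hr.2
  obtain ⟨s', hs, hs'1⟩ := exists_between hs1
  obtain ⟨s'', hs'', hs''1⟩ := exists_between hs'1
  have hr0 := hr.1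
  obtain ⟨C, hC⟩ := hf.exists_forall_ball_norm_le ha hA hs''1
  have hC0 : 0 ≤ C := (norm_nonneg _).trans (hC 0 (mem_ball_self (by linarith)))
  have hlnorm : ‖(l : ℂ)‖ = l := by rw [Complex.norm_real, Real.norm_of_nonneg hl.le]
  have hsub : ball (0 : X) s' ⊆ ball 0 1 := ball_subset_ball hs'1.le
  have hsub' : ball (0 : X) s' ⊆ ball 0 s'' := ball_subset_ball hs''.le
  have hL : 0 ≤ 2 * C / (s'' - s') := div_nonneg (by linarith) (by linarith)
  obtain ⟨g, hg, hgx⟩ := exists_zero_differentiableOn (U := ball (0 : X) r) isOpen_ball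
    (q := r) (s := s) (s' := s') (N := s' + l * C + r) (L := 1 + l * (2 * C / (s'' - s')))
    (Φ := fun p => p.2 + (l : ℂ) • f p.2 - p.1) hr0.le hrs hs
    (by have : 0 < s' := by linarith
        positivity) (by positivity)
    ((differentiableOn_snd.add ((hf.holo.comp differentiableOn_snd
      fun p hp => hsub hp.2).const_smul _)).sub differentiableOn_fst)
    (fun x hx w hw => by
      have h1 := mem_ball_zero_iff.1 hx
      have h2 := mem_ball_zero_iff.1 hw
      have h3 : ‖(l : ℂ) • f w‖ ≤ l * C := by
        rw [norm_smul, hlnorm]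
        exact mul_le_mul_of_nonneg_left (hC w (hsub' hw)) hl.le
      linarith [norm_sub_le (w + (l : ℂ) • f w) x, norm_add_le w ((l : ℂ) • f w)])
    (fun x _ w hw v hv => by
      have h2 : ‖(l : ℂ) • (f w - f v)‖ ≤ l * (2 * C / (s'' - s') * ‖w - v‖) := by
        rw [norm_smul, hlnorm]
        exact mul_le_mul_of_nonneg_left (norm_sub_le_of_forall_ball_norm_le hs''
          (hf.holo.mono (ball_subset_ball hs''1.le)) hC hw hv) hl.le
      calc _ = ‖(w - v) + (l : ℂ) • (f w - f v)‖ := by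
            congr 1; simp only [smul_sub]; abel
        _ ≤ ‖w - v‖ + ‖(l : ℂ) • (f w - f v)‖ := norm_add_le _ _
        _ ≤ _ := by linarith)
    (fun x hx v hv ψ hψ => by
      have h1 := mul_le_mul_of_nonneg_left (mem_ball_zero_iff.1 hx).le (norm_nonneg v)
      have h2 := mul_nonneg hl.le ((mul_nonneg ha (sq_nonneg _)).trans
        (hf.accretive v (hsub hv) ψ hψ))
      have h3 := re_apply_le_of_mem_supportFunctionals hψ x
      simp only [map_sub, map_add, map_smul, smul_eq_mul, Complex.sub_re, Complex.add_re,
        Complex.re_ofReal_mul]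
      rw [re_apply_self_of_mem_supportFunctionals hψ]
      nlinarith)
  refine ⟨g, hg, fun x hx => ⟨ball_subset_ball hs1.le (hgx x hx).1,
    sub_eq_zero.1 (hgx x hx).2.1, fun w hw hwx => (hgx x hx).2.2 w ?_ (sub_eq_zero.2 hwx)⟩⟩
  -- Any solution in the unit ball satisfies `‖w‖ ≤ ‖x‖ < r < s`, so uniqueness in the smaller ball
  -- is enough.
  rw [mem_ball_zero_iff] at hx ⊢
  linarith [hf.norm_le_of_resolvent_eq ha hl hw hwx]

/-- The holomorphic solutions over balls of radius `r < 1` agree by uniqueness, so the pointwise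
solution is locally one of them. -/
theorem ClassN.exists_isResolvent (ha : 0 ≤ a) (hf : ClassN a f)
    (hA : StronglyAccretive (fderiv ℂ f 0)) (hl : 0 < l) : ∃ g, IsResolvent f l g := by
  have hrad : ∀ x ∈ ball (0 : X) 1, ∃ r ∈ Ioo (0 : ℝ) 1, x ∈ ball (0 : X) r := fun x hx => by
    obtain ⟨r, hxr, hr1⟩ := exists_between (mem_ball_zero_iff.1 hx)
    exact ⟨r, ⟨(norm_nonneg x).trans_lt hxr, hr1⟩, mem_ball_zero_iff.2 hxr⟩
  have hex : ∀ x ∈ ball (0 : X) 1, ∃ w ∈ ball (0 : X) 1, w + (l : ℂ) • f w = x ∧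
      ∀ v ∈ ball 0 1, v + (l : ℂ) • f v = x → v = w := fun x hx => by
    obtain ⟨r, hr, hxr⟩ := hrad x hx
    obtain ⟨g, -, hg⟩ := hf.exists_resolvent_ball ha hA hl hr
    exact ⟨g x, hg x hxr⟩
  choose! G hGmem hGeq hGuniq using hex
  refine ⟨G, fun x hx => ?_, hGmem, hGeq, fun x hx w hw => hGuniq x hx w hw⟩
  obtain ⟨r, hr, hxr⟩ := hrad x hx
  obtain ⟨g, hgd, hg⟩ := hf.exists_resolvent_ball ha hA hl hr
  have hnhds : ball (0 : X) r ∈ 𝓝 x := isOpen_ball.mem_nhds hxr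
  refine ((hgd.differentiableAt hnhds).congr_of_eventuallyEq ?_).differentiableWithinAt
  filter_upwards [hnhds] with y hy
  have hy1 := ball_subset_ball hr.2.le hy
  exact (hg y hy).2.2 _ (hGmem y hy1) (hGeq y hy1)

theorem ClassN.M_lt_top (ha : 0 ≤ a) (hf : ClassN a f)
    (hA : StronglyAccretive (fderiv ℂ f 0)) {r : ℝ} (hr : r < 1) : M f r < ⊤ := by
  obtain ⟨C, hC⟩ := hf.exists_forall_ball_norm_le ha hA hr
  exact (iSup₂_le fun y hy => ENNReal.ofReal_le_ofReal (hC y hy)).trans_lt ENNReal.ofReal_lt_top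

end Resolvent

end NonlinearResolvent

theorem theorem1p1 {X : Type*} [NormedAddCommGroup X] [NormedSpace ℂ X] [CompleteSpace X]
    (a : ℝ) (ha : 0 ≤ a) (f : X → X) (hf : NonlinearResolvent.ClassN a f)
    (hA : NonlinearResolvent.StronglyAccretive (fderiv ℂ f 0)) :
    (∀ l : ℝ, 0 < l → ∃ g : X → X, NonlinearResolvent.IsResolvent f l g) ∧
    (∀ r : ℝ, 0 < r → r < 1 → NonlinearResolvent.M f r < ⊤) ∧
    ∀ G : ℝ → X → X, (∀ l : ℝ, 0 < l → NonlinearResolvent.IsResolvent f l (G l)) →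
      (∀ l : ℝ, 0 < l → ∀ x ∈ Metric.ball (0 : X) 1,
        NonlinearResolvent.beta a f l * ‖x‖ ≤ ‖G l x‖ ∧
        ‖G l x‖ ≤ NonlinearResolvent.alpha a f l * ‖x‖) ∧
      TendstoUniformlyOn G (fun _ => 0) Filter.atTop (Metric.ball (0 : X) 1) ∧
      (FiniteDimensional ℂ X → ∀ l : ℝ, 0 < l →
        Metric.ball (0 : X) (NonlinearResolvent.beta a f l) ⊆ G l '' Metric.ball (0 : X) 1) :=
  ⟨fun _ hl => hf.exists_isResolvent ha hA hl, fun _ _ hr => hf.M_lt_top ha hA hr, fun _ hG =>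
    ⟨fun l hl _ hx => ⟨(hG l hl).beta_mul_le ha hf hA hl hx,
      (hG l hl).norm_le_alpha_mul ha hf hA hl hx⟩,
    NonlinearResolvent.tendstoUniformlyOn_resolvent ha hf hA hG,
    fun _ l hl => (hG l hl).ball_beta_subset ha hf hA hl⟩⟩
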